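/- Let $\nu\in\mathbb R$. Let $F_\nu(z)={}_2F_1(\nu+\tfrac12,\nu+\tfrac12;1;z)$ for real $z<1$, where the Gauss hypergeometric series, convergent for $|z|<1$, is continued analytically to $(-\infty,1)$. Let $p(\nu)$ be the largest negative zero of $F_\nu$ if $F_\nu$ has a negative zero, and put $p(\nu)=-\infty$ otherwise. Let $K_\nu$ be the modified Bessel function of the second kind (principal branch on $|\arg z|<\pi$), and let $x\in\mathbb C\setminus\{0\}$. Assume that $|\arg x|<\pi$ if $p(\nu)=-\infty$, and that $|\arg x|\le\theta$ if $p(\nu)>-\infty$, where $\theta$ is the angle with $\tfrac12\pi<\theta<\pi$ and $$\tan\theta=-\frac{1}{(-p(\nu))^{1/2}} .$$ Then the function $$f(t)=e^{2t\operatorname{Re}x}\,|K_\nu(tx)|^2,\qquad t>0,$$ is strictly completely monotone on $(0,\infty)$, that is, $f$ is infinitely differentiable and $(-1)^n f^{(n)}(t)>0$ for all $t>0$ and all $n=0,1,2,\dots$ -/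

import Mathlib

open scoped ContDiff

noncomputable section

/-- Whittaker's function `W_{k,m}(z)` on the plane cut along `(-∞, 0]`, for real `m` and complex `k`
with `Re k < 1/2` (this makes the integral converge), by Whittaker's integral
`W_{k,m}(z) = e^{-z/2} z^k / Γ(1/2 + m - k) * ∫_0^∞ e^{-u} u^{m-k-1/2} (1 + u/z)^{m+k-1/2} du`,
taken for `m ≥ 0` and extended to `m < 0` by `W_{k,-m} = W_{k,m}`. Powers are principal values; for
`z` off the cut, `1 + u/z` stays off the cut too. -/
def whittakerW (k : ℂ) (m : ℝ) (z : ℂ) : ℂ :=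
  Complex.exp (-z / 2) * z ^ k / Complex.Gamma (1 / 2 + (|m| : ℝ) - k) *
    ∫ u in Set.Ioi (0 : ℝ), Complex.exp (-(u : ℂ)) * (u : ℂ) ^ (((|m| : ℝ) : ℂ) - k - 1 / 2) *
      (1 + (u : ℂ) / z) ^ (((|m| : ℝ) : ℂ) + k - 1 / 2)

/-- The modified Bessel function (Macdonald function) of real order on the plane cut along
`(-∞, 0]`: `K_ν(z) = (π / (2 z))^{1/2} W_{0,ν}(2 z)`. -/
def besselK (ν : ℝ) (z : ℂ) : ℂ :=
  ((Real.pi : ℂ) / (2 * z)) ^ (1 / 2 : ℂ) * whittakerW 0 ν (2 * z)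

/-- The hypergeometric function `₂F₁(a, b; c; z)` on `(-∞, 1)`: the real-analytic continuation to
`(-∞, 1)` of the sum of the hypergeometric series on `(-1, 1)`. It exists for `c ≠ 0, -1, -2, …`
(it is the restriction of the principal branch), and its values on `(-∞, 1)` are unique. -/
def hypergeometricF (a b c : ℝ) : ℝ → ℝ :=
  Classical.epsilon fun G : ℝ → ℝ =>
    AnalyticOnNhd ℝ G (Set.Iio 1) ∧ ∀ z ∈ Set.Ioo (-1 : ℝ) 1, G z = ordinaryHypergeometric a b c z

/-- The negative zeros of `₂F₁(ν + 1/2, ν + 1/2; 1; z)`. -/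
def negativeZeros (ν : ℝ) : Set ℝ :=
  {z | z < 0 ∧ hypergeometricF (ν + 1 / 2) (ν + 1 / 2) 1 z = 0}

/-- `p(ν)`: the largest negative zero of `₂F₁(ν + 1/2, ν + 1/2; 1; z)`, or `-∞` if there is none
(the supremum of the empty set in the extended reals). The function is continuous on `(-∞, 1)` and
equals `1` at `0`, so the supremum of a nonempty set of negative zeros is a negative zero. -/
def largestNegativeZero (ν : ℝ) : EReal :=
  sSup ((fun z : ℝ => (z : EReal)) '' negativeZeros ν)

/-- `f` is strictly completely monotone on `(0, ∞)`: it is infinitely differentiable there and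
`(-1)^n f^{(n)}(t) > 0` for all `t > 0` and all `n = 0, 1, 2, …`. -/
def StrictlyCompletelyMonotone (f : ℝ → ℝ) : Prop :=
  ContDiffOn ℝ ∞ f (Set.Ioi 0) ∧
    ∀ n : ℕ, ∀ t : ℝ, 0 < t → 0 < (-1 : ℝ) ^ n * iteratedDeriv n f t

end

/-! Put a = |ν| + 1/2, α = 1/(2x) and G(ρ) = ₂F₁(a, 1-a; 1; 1-ρ). Up to elementary factors, e^{tx}
K_ν(tx) is the Laplace transform at t of τ^(a-1) (1 + ατ)^(a-1). Its squared modulus is the product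
with the conjugate transform, hence the transform of a convolution. By `laplaceMellin_product` this
product equals Γ(a)² t^(1-2a) ∫ e^{-tτ} G(|1 + ατ|²) dτ. The powers of t cancel, so f(t) = π/(2|x|)
∫ e^{-tτ} G(|1 + ατ|²) dτ (`exp_mul_norm_besselK_sq`). Such a transform is strictly completely
monotone once its density is continuous, nonnegative and positive at 0, and G(1) = 1.

Nonnegativity (`legendreFun_re_nonneg`) rests on Pfaff's formula G(ρ) = ρ^(-a) ₂F₁(a, a; 1; 1-1/ρ).
For ρ ≥ 1 the argument lies in [0, 1) and the coefficients are squares. If ρ < 1 occurs, then Re x <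
0, and minimising |1 + ατ|² over τ gives 1 - 1/ρ ≥ -(Re x / Im x)². The angle condition puts this at
or to the right of p(ν), and by the intermediate value theorem ₂F₁ is nonnegative between p(ν) and
0.

The product formula comes from `integral_convKernel_eq`, an identity of fractional integrals. Near 0
both of its sides are double power series, compared termwise through beta integrals; on the
hypergeometric side the series is Appell's F₃, which reduces to a Gauss function
(`hasSum_appellCoeff`). The identity theorem on a star-shaped domain carries the identity to the
half-line. -/

open Complex MeasureTheory Set Filter Topology Asymptotics


/-! ### Power series with polynomially bounded coefficients -/

/-- A sequence bounded by a polynomial. -/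
def PolyGrowth (c : ℕ → ℂ) : Prop := ∃ (C : ℝ) (N : ℕ), ∀ k, ‖c k‖ ≤ C * ((k : ℝ) + 1) ^ N

lemma summable_add_one_pow_mul_geometric (N : ℕ) {r : ℝ} (h0 : 0 ≤ r) (h1 : r < 1) :
    Summable fun k : ℕ => ((k : ℝ) + 1) ^ N * r ^ k := by
  have hr : ‖r‖ < 1 := by rwa [Real.norm_of_nonneg h0]
  refine Summable.of_nonneg_of_le (fun k => by positivity) (fun k => ?_)
    (summable_descFactorial_mul_geometric_of_norm_lt_one N hr)
  gcongr
  have := Nat.pow_sub_le_descFactorial (k + N) N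
  rw [show k + N + 1 - N = k + 1 by omega] at this
  exact_mod_cast this

namespace PolyGrowth

lemma mono_norm {c d : ℕ → ℂ} (hc : PolyGrowth c) (h : ∀ k, ‖d k‖ ≤ ‖c k‖) : PolyGrowth d := by
  obtain ⟨C, N, hC⟩ := hc
  exact ⟨C, N, fun k => (h k).trans (hC k)⟩

lemma const_mul {c : ℕ → ℂ} (hc : PolyGrowth c) (b : ℂ) : PolyGrowth fun k => b * c k := by
  obtain ⟨C, N, hC⟩ := hc
  refine ⟨‖b‖ * C, N, fun k => ?_⟩
  rw [norm_mul, mul_assoc]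
  gcongr
  exact hC k

lemma summable_norm {c : ℕ → ℂ} (hc : PolyGrowth c) {z : ℂ} (hz : ‖z‖ < 1) :
    Summable fun k => ‖c k * z ^ k‖ := by
  obtain ⟨C, N, hC⟩ := hc
  refine Summable.of_nonneg_of_le (fun k => norm_nonneg _) (fun k => ?_)
    ((summable_add_one_pow_mul_geometric N (norm_nonneg z) hz).mul_left C)
  rw [norm_mul, norm_pow, ← mul_assoc]
  gcongr
  exact hC k

lemma summable {c : ℕ → ℂ} (hc : PolyGrowth c) {z : ℂ} (hz : ‖z‖ < 1) :
    Summable fun k => c k * z ^ k := (hc.summable_norm hz).of_norm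

lemma succ_mul {c : ℕ → ℂ} (hc : PolyGrowth c) : PolyGrowth fun k => (k + 1) * c (k + 1) := by
  obtain ⟨C, N, hC⟩ := hc
  have hC0 : 0 ≤ C := by simpa using (norm_nonneg _).trans (hC 0)
  refine ⟨C * 2 ^ N, N + 1, fun k => ?_⟩
  have h1 := hC (k + 1)
  rw [norm_mul]
  have h2 : ‖(k : ℂ) + 1‖ = k + 1 := by
    rw [← Nat.cast_add_one, Complex.norm_natCast]; push_cast; rfl
  rw [h2]
  calc ((k : ℝ) + 1) * ‖c (k + 1)‖ ≤ (k + 1) * (C * (((k + 1 : ℕ) : ℝ) + 1) ^ N) := by gcongr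
    _ ≤ (k + 1) * (C * (2 * ((k : ℝ) + 1)) ^ N) := by
        gcongr; push_cast; linarith [(Nat.cast_nonneg k : (0 : ℝ) ≤ k)]
    _ = _ := by rw [mul_pow]; ring

lemma hasDerivAt {c : ℕ → ℂ} (hc : PolyGrowth c) {z : ℂ} (hz : ‖z‖ < 1) :
    HasDerivAt (fun z => ∑' k, c k * z ^ k) (∑' k, (k + 1) * c (k + 1) * z ^ k) z := by
  -- An intermediate radius gives a summable majorant of the derivatives, uniform on the ball of
  -- radius r.
  obtain ⟨r, hzr, hr1⟩ := exists_between hz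
  have hr0 : 0 ≤ r := (norm_nonneg z).trans hzr.le
  have hrn : ‖(r : ℂ)‖ < 1 := by rwa [Complex.norm_real, Real.norm_of_nonneg hr0]
  have hu : Summable fun k : ℕ => ‖(k : ℂ) * c k * (r : ℂ) ^ (k - 1)‖ := by
    rw [← summable_nat_add_iff 1]
    simpa using hc.succ_mul.summable_norm hrn
  have key := hasDerivAt_tsum_of_isPreconnected (t := Metric.ball (0 : ℂ) r)
    (g := fun (k : ℕ) z => c k * z ^ k) (g' := fun (k : ℕ) z => (k : ℂ) * c k * z ^ (k - 1))
    hu Metric.isOpen_ball (convex_ball _ _).isPreconnected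
    (fun k y _ => by
      have := (hasDerivAt_pow k y).const_mul (c k)
      exact this.congr_deriv (by ring))
    (fun k y hy => by
      rw [mem_ball_zero_iff] at hy
      rw [norm_mul, norm_mul ((k : ℂ) * c k), norm_pow, norm_pow, Complex.norm_real,
        Real.norm_of_nonneg hr0]
      gcongr)
    (mem_ball_zero_iff.2 hzr) (hc.summable hz) (mem_ball_zero_iff.2 hzr)
  refine key.congr_deriv ?_
  have hs : Summable fun k : ℕ => (k : ℂ) * c k * z ^ (k - 1) := by
    rw [← summable_nat_add_iff 1]
    simpa using hc.succ_mul.summable hz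
  rw [hs.tsum_eq_zero_add]
  simp

lemma differentiableOn {c : ℕ → ℂ} (hc : PolyGrowth c) :
    DifferentiableOn ℂ (fun z => ∑' k, c k * z ^ k) (Metric.ball 0 1) := fun _ hz =>
  (hc.hasDerivAt (mem_ball_zero_iff.1 hz)).differentiableAt.differentiableWithinAt

end PolyGrowth

/-! ### The Gauss series on the unit disc -/

/-- Coefficients of the Gauss series `₂F₁(a, b; 1; z)`. -/
noncomputable def gaussCoeff (a b : ℝ) (k : ℕ) : ℝ :=
  (ascPochhammer ℝ k).eval a * (ascPochhammer ℝ k).eval b / (k.factorial : ℝ) ^ 2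

/-- The sum of the Gauss series `₂F₁(a, b; 1; z)` on the complex unit disc. -/
noncomputable def gaussSeries (a b : ℝ) (z : ℂ) : ℂ := ∑' k, (gaussCoeff a b k : ℂ) * z ^ k

lemma gaussCoeff_zero (a b : ℝ) : gaussCoeff a b 0 = 1 := by simp [gaussCoeff]

lemma gaussCoeff_succ (a b : ℝ) (k : ℕ) :
    gaussCoeff a b (k + 1) = gaussCoeff a b k * ((a + k) * (b + k) / ((k : ℝ) + 1) ^ 2) := by
  have : (k.factorial : ℝ) ≠ 0 := by exact_mod_cast k.factorial_ne_zero
  simp only [gaussCoeff, ascPochhammer_succ_eval, Nat.factorial_succ]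
  push_cast
  field_simp

lemma gaussCoeff_comm (a b : ℝ) : gaussCoeff a b = gaussCoeff b a := by
  ext k; simp only [gaussCoeff]; ring

lemma gaussCoeff_self_nonneg (a : ℝ) (k : ℕ) : 0 ≤ gaussCoeff a a k := by
  rw [gaussCoeff, ← sq]; positivity

/-- Each ratio (a + k) / (k + 1) has modulus at most 1 + N / (k + 1), hence at most ((k + 2) / (k +
1)) ^ N by Bernoulli's inequality, and these bounds telescope. -/
lemma abs_ascPochhammer_div_factorial_le {a : ℝ} {N : ℕ} (h : |a| ≤ N) (k : ℕ) :
    |(ascPochhammer ℝ k).eval a / k.factorial| ≤ ((k : ℝ) + 1) ^ N := by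
  induction k with
  | zero => simp
  | succ k ih =>
    have hf : (0 : ℝ) < k.factorial := by exact_mod_cast k.factorial_pos
    have e : (ascPochhammer ℝ (k + 1)).eval a / (k + 1).factorial
        = (ascPochhammer ℝ k).eval a / k.factorial * ((a + k) / (k + 1)) := by
      simp only [ascPochhammer_succ_eval, Nat.factorial_succ]
      push_cast
      field_simp
    rw [e, abs_mul]
    have h1 : |(a + k) / ((k : ℝ) + 1)| ≤ (1 + 1 / ((k : ℝ) + 1)) ^ N := by
      have h2 := one_add_mul_le_pow (a := 1 / ((k : ℝ) + 1))
        (by have : (0:ℝ) ≤ 1 / ((k : ℝ) + 1) := by positivity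
            linarith) N
      refine le_trans ?_ h2
      rw [abs_div, abs_of_pos (by positivity : (0 : ℝ) < k + 1), div_le_iff₀ (by positivity)]
      have h3 : (1 + (N : ℝ) * (1 / (k + 1))) * (k + 1) = k + 1 + N := by field_simp
      rw [h3]
      have := abs_add_le a k
      rw [abs_of_nonneg (Nat.cast_nonneg k : (0 : ℝ) ≤ k)] at this
      linarith
    calc _ ≤ ((k : ℝ) + 1) ^ N * (1 + 1 / ((k : ℝ) + 1)) ^ N := by gcongr
      _ = _ := by rw [← mul_pow]; congr 1; push_cast; field_simp

lemma abs_gaussCoeff_le {a b : ℝ} {N : ℕ} (ha : |a| ≤ N) (hb : |b| ≤ N) (k : ℕ) :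
    |gaussCoeff a b k| ≤ ((k : ℝ) + 1) ^ (2 * N) := by
  have : gaussCoeff a b k = (ascPochhammer ℝ k).eval a / k.factorial *
      ((ascPochhammer ℝ k).eval b / k.factorial) := by
    rw [gaussCoeff, div_mul_div_comm, sq]
  rw [this, abs_mul, two_mul, pow_add]
  gcongr
  exacts [abs_ascPochhammer_div_factorial_le ha k, abs_ascPochhammer_div_factorial_le hb k]

lemma polyGrowth_gaussCoeff (a b : ℝ) : PolyGrowth fun k => (gaussCoeff a b k : ℂ) := by
  obtain ⟨N, hN⟩ := exists_nat_ge (max |a| |b|)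
  refine ⟨1, 2 * N, fun k => ?_⟩
  rw [Complex.norm_real, Real.norm_eq_abs, one_mul]
  exact abs_gaussCoeff_le ((le_max_left _ _).trans hN) ((le_max_right _ _).trans hN) k

lemma summable_gaussCoeff (a b : ℝ) {x : ℝ} (hx : |x| < 1) :
    Summable fun k => gaussCoeff a b k * x ^ k := by
  have h := (polyGrowth_gaussCoeff a b).summable (z := (x : ℂ))
    (by rwa [Complex.norm_real, Real.norm_eq_abs])
  exact_mod_cast h

lemma gaussSeries_ofReal (a b x : ℝ) :
    gaussSeries a b x = ((∑' k, gaussCoeff a b k * x ^ k : ℝ) : ℂ) := by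
  rw [gaussSeries]; push_cast; rfl

lemma gaussSeries_zero (a b : ℝ) : gaussSeries a b 0 = 1 := by
  rw [gaussSeries, tsum_eq_single 0 (fun k hk => by simp [hk])]
  simp [gaussCoeff_zero]

lemma ordinaryHypergeometric_one_eq_tsum (a b x : ℝ) :
    ordinaryHypergeometric a b 1 x = ∑' k, gaussCoeff a b k * x ^ k := by
  rw [ordinaryHypergeometric_eq_tsum]
  refine tsum_congr fun k => ?_
  have : (k.factorial : ℝ) ≠ 0 := by exact_mod_cast k.factorial_ne_zero
  rw [gaussCoeff, ascPochhammer_eval_one, smul_eq_mul]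
  field_simp

lemma differentiableOn_gaussSeries (a b : ℝ) : DifferentiableOn ℂ (gaussSeries a b) (Metric.ball 0 1) :=
  (polyGrowth_gaussCoeff a b).differentiableOn

/-- For equal parameters the Gauss series is positive and grows at most polynomially in
`1 / (1 - x)` on `[0, 1)`. -/
lemma one_le_tsum_gaussCoeff_self (a : ℝ) {x : ℝ} (h0 : 0 ≤ x) (h1 : x < 1) :
    1 ≤ ∑' k, gaussCoeff a a k * x ^ k := by
  have hs := summable_gaussCoeff a a (by rwa [abs_of_nonneg h0] : |x| < 1)
  have := hs.le_tsum 0 (fun k _ => mul_nonneg (gaussCoeff_self_nonneg a k) (pow_nonneg h0 k))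
  simpa [gaussCoeff_zero] using this

lemma exists_tsum_gaussCoeff_self_le (a : ℝ) : ∃ (C : ℝ) (N : ℕ), 0 ≤ C ∧ ∀ x : ℝ, 0 ≤ x → x < 1 →
    ∑' k, gaussCoeff a a k * x ^ k ≤ C * (1 / (1 - x)) ^ N := by
  obtain ⟨N, hN⟩ := exists_nat_ge |a|
  -- The coefficients are at most (k + 1)^(2N) ≤ (2N)! · C(k + 2N, 2N), and the binomials have
  -- generating function (1 - x)^(-(2N + 1)).
  refine ⟨(2 * N).factorial, 2 * N + 1, by positivity, fun x h0 h1 => ?_⟩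
  have hx : ‖x‖ < 1 := by rwa [Real.norm_of_nonneg h0]
  have hs := summable_gaussCoeff a a hx
  have h2 := (hasSum_choose_mul_geometric_of_norm_lt_one (2 * N) hx).mul_left
    ((2 * N).factorial : ℝ)
  rw [one_div_pow, ← h2.tsum_eq]
  refine hs.tsum_le_tsum (fun k => ?_) h2.summable
  rw [← mul_assoc]
  gcongr
  refine ((le_abs_self _).trans (abs_gaussCoeff_le hN hN k)).trans ?_
  have h3 := Nat.pow_sub_le_descFactorial (k + 2 * N) (2 * N)
  rw [show k + 2 * N + 1 - 2 * N = k + 1 by omega, Nat.descFactorial_eq_factorial_mul_choose] at h3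
  exact_mod_cast h3

/-! ### Binomial series and Pfaff's transformation -/

/-- `(a)_n / n!`. -/
noncomputable def risingCoeff (a : ℝ) (n : ℕ) : ℝ := (ascPochhammer ℝ n).eval a / n.factorial

lemma risingCoeff_zero (a : ℝ) : risingCoeff a 0 = 1 := by simp [risingCoeff]

lemma risingCoeff_succ (a : ℝ) (n : ℕ) :
    risingCoeff a (n + 1) = risingCoeff a n * ((a + n) / (n + 1)) := by
  have hf : (n.factorial : ℝ) ≠ 0 := by exact_mod_cast n.factorial_ne_zero
  simp only [risingCoeff, ascPochhammer_succ_eval, Nat.factorial_succ]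
  push_cast
  field_simp

lemma gaussCoeff_eq_risingCoeff_mul (a b : ℝ) (n : ℕ) :
    gaussCoeff a b n = risingCoeff a n * risingCoeff b n := by
  rw [gaussCoeff, risingCoeff, risingCoeff, div_mul_div_comm, sq]

lemma multichoose_eq_risingCoeff (a : ℝ) (n : ℕ) : Ring.multichoose a n = risingCoeff a n := by
  have hf : (n.factorial : ℝ) ≠ 0 := by exact_mod_cast n.factorial_ne_zero
  have h := Ring.factorial_nsmul_multichoose_eq_ascPochhammer a n
  rw [Polynomial.ascPochhammer_smeval_eq_eval, nsmul_eq_mul] at h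
  rw [risingCoeff, ← h]
  field_simp

lemma choose_eq_risingCoeff (a : ℝ) (n : ℕ) : Ring.choose a n = risingCoeff (a - n + 1) n := by
  rw [← multichoose_eq_risingCoeff]; rfl

lemma choose_neg_eq_risingCoeff (a : ℝ) (n : ℕ) :
    Ring.choose (-a) n = (-1) ^ n * risingCoeff a n := by
  rw [Ring.choose_neg, choose_eq_risingCoeff, show a + n - 1 - n + 1 = a by ring]
  simp [Units.smul_def]

lemma abs_risingCoeff_le {a b : ℝ} (h : |a| ≤ b) (n : ℕ) : |risingCoeff a n| ≤ risingCoeff b n := by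
  induction n with
  | zero => simp [risingCoeff_zero]
  | succ n ih =>
    have hb : 0 ≤ b := (abs_nonneg a).trans h
    rw [risingCoeff_succ, risingCoeff_succ, abs_mul, abs_div,
      abs_of_pos (by positivity : (0 : ℝ) < n + 1)]
    have : |a + n| ≤ b + n := (abs_add_le _ _).trans
      (by rw [abs_of_nonneg (Nat.cast_nonneg n : (0 : ℝ) ≤ n)]; linarith)
    have h0 := (abs_nonneg _).trans ih
    gcongr

/-- Both sides are (a)_{k+j} / (k! j!). -/
lemma risingCoeff_mul_risingCoeff_add (a : ℝ) (k j : ℕ) :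
    risingCoeff a k * risingCoeff (a + k) j = (k + j).choose k * risingCoeff a (k + j) := by
  induction j with
  | zero => simp [risingCoeff_zero]
  | succ j ih =>
    rw [← add_assoc, risingCoeff_succ, risingCoeff_succ a (k + j), ← mul_assoc, ih]
    have h : ((k + j + 1).choose k : ℝ) * (j + 1) = (k + j).choose k * (k + j + 1) := by
      have := Nat.choose_mul_succ_eq (k + j) k
      rw [show k + j + 1 - k = j + 1 by omega] at this
      exact_mod_cast this.symm
    have h1 : (j : ℝ) + 1 ≠ 0 := by positivity
    have h2 : (k : ℝ) + j + 1 ≠ 0 := by positivity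
    push_cast
    field_simp
    linear_combination -(risingCoeff a (k + j) * (a + k + j)) * h

/-- A case of the Chu-Vandermonde identity. -/
lemma sum_antidiagonal_risingCoeff_mul_choose (a : ℝ) (n : ℕ) :
    ∑ ij ∈ Finset.HasAntidiagonal.antidiagonal n, (-1) ^ ij.1 * risingCoeff a ij.1 * (n.choose ij.1 : ℝ)
      = risingCoeff (1 - a) n := by
  have h := Ring.add_choose_eq (r := -a) (s := (n : ℝ)) n (Commute.all _ _)
  rw [choose_eq_risingCoeff, show -a + n - n + 1 = 1 - a by ring] at h
  rw [h]
  refine Finset.sum_congr rfl fun ij hij => ?_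
  rw [choose_neg_eq_risingCoeff, Ring.choose_natCast,
    Nat.choose_symm_of_eq_add (Finset.HasAntidiagonal.mem_antidiagonal.1 hij).symm]

lemma hasSum_risingCoeff (b : ℝ) {x : ℂ} (hx : ‖x‖ < 1) :
    HasSum (fun j => (risingCoeff b j : ℂ) * x ^ j) ((1 - x) ^ (-b : ℂ)) := by
  have h := (one_add_cpow_hasFPowerSeriesOnBall_zero (a := (-b : ℂ))).hasSum (y := -x)
    (by rw [Metric.mem_eball, edist_zero_right, enorm_neg]; 
        rw [← ofReal_norm, ENNReal.ofReal_lt_one]; exact hx)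
  simp only [binomialSeries_apply] at h
  rw [zero_add, ← sub_eq_add_neg] at h
  convert! h using 2 with j
  rw [← ofReal_neg, ← ofReal_choose, choose_neg_eq_risingCoeff]
  have h1 : (-1 : ℂ) ^ j * (-1) ^ j = 1 := by rw [← mul_pow]; simp
  simp only [List.prod_ofFn, Finset.prod_const, Finset.card_univ, Fintype.card_fin, smul_eq_mul]
  push_cast
  rw [neg_pow x]
  linear_combination -((risingCoeff b j : ℂ) * x ^ j) * h1

lemma hasSum_risingCoeff_real (b : ℝ) {x : ℝ} (h0 : 0 ≤ x) (h1 : x < 1) :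
    HasSum (fun j => risingCoeff b j * x ^ j) ((1 - x) ^ (-b)) := by
  have h := hasSum_risingCoeff b (x := (x : ℂ)) (by rwa [norm_real, Real.norm_of_nonneg h0])
  have e : (1 - (x : ℂ)) ^ (-b : ℂ) = (((1 - x) ^ (-b) : ℝ) : ℂ) := by
    rw [ofReal_cpow (by linarith)]; push_cast; rfl
  rw [e] at h
  exact_mod_cast h

/-- Pfaff's transformation, near the origin. -/
lemma gaussSeries_pfaff (a : ℝ) {w : ℂ} (hw : ‖w‖ < 1 / 2) :
    gaussSeries a (1 - a) w = (1 - w) ^ (-a : ℂ) * gaussSeries a a (w / (w - 1)) := by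
  set r := ‖w‖ with hr
  have hr0 : 0 ≤ r := norm_nonneg w
  have hr1 : r < 1 := by linarith
  have hw1 : ‖w‖ < 1 := hr1
  have hne : (1 - w) ≠ 0 := by
    intro h
    have : w = 1 := by linear_combination -h
    rw [this] at hw1; simp at hw1
  -- Expanding (1 - w)^(-a-k) in the k-th term on the right gives this double series. Its rows sum
  -- to the right side; its antidiagonals, by Chu-Vandermonde, to the terms on the left.
  let F : ℕ × ℕ → ℂ := fun x => (gaussCoeff a a x.1 : ℂ) * (-w) ^ x.1 *
    ((risingCoeff (a + x.1) x.2 : ℂ) * w ^ x.2)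
  have hrow : ∀ k, HasSum (fun j => F (k, j))
      ((1 - w) ^ (-a : ℂ) * ((gaussCoeff a a k : ℂ) * (w / (w - 1)) ^ k)) := fun k => by
    have := (hasSum_risingCoeff (a + k) hw1).mul_left ((gaussCoeff a a k : ℂ) * (-w) ^ k)
    convert! this using 1
    rw [show (-((a + k : ℝ) : ℂ)) = -a - k by push_cast; ring, cpow_sub _ _ hne, cpow_natCast,
      show w / (w - 1) = -w / (1 - w) by rw [← neg_sub 1 w, div_neg, neg_div], div_pow]
    ring
  have hsum : Summable F := by
    refine Summable.of_norm ((summable_prod_of_nonneg fun x => norm_nonneg _).2 ⟨fun k => ?_, ?_⟩)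
    · exact (hrow k).summable.norm
    -- Absolute values bound the k-th row by a multiple of a term of the Gauss series at r / (1 -
    -- r), which is below 1 because r < 1/2.
    · have hb : ∀ k, ∑' j, ‖F (k, j)‖
          ≤ (1 - r) ^ (-|a|) * ‖(gaussCoeff a a k : ℂ) * ((r / (1 - r) : ℝ) : ℂ) ^ k‖ := fun k => by
        have h1 := (hasSum_risingCoeff_real (|a| + k) hr0 hr1).mul_left
          (‖(gaussCoeff a a k : ℂ)‖ * r ^ k)
        have h2 : ‖(gaussCoeff a a k : ℂ)‖ * r ^ k * (1 - r) ^ (-(|a| + k))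
            = (1 - r) ^ (-|a|) * ‖(gaussCoeff a a k : ℂ) * ((r / (1 - r) : ℝ) : ℂ) ^ k‖ := by
          rw [norm_mul, norm_pow, norm_real (r / (1 - r)),
            Real.norm_of_nonneg (div_nonneg hr0 (by linarith)), neg_add, ← sub_eq_add_neg,
            Real.rpow_sub (by linarith), Real.rpow_natCast, div_pow]
          ring
        rw [h2] at h1
        rw [← h1.tsum_eq]
        refine (hrow k).summable.norm.tsum_le_tsum (fun j => ?_) h1.summable
        simp only [F, norm_mul, norm_pow, norm_neg, ← hr]
        gcongr
        rw [norm_real, Real.norm_eq_abs]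
        refine abs_risingCoeff_le ((abs_add_le _ _).trans ?_) j
        rw [abs_of_nonneg (Nat.cast_nonneg k : (0 : ℝ) ≤ k)]
      refine Summable.of_nonneg_of_le (fun k => tsum_nonneg fun j => norm_nonneg _) hb
        (((polyGrowth_gaussCoeff a a).summable_norm ?_).mul_left _)
      rw [norm_real, Real.norm_of_nonneg (div_nonneg hr0 (by linarith)), div_lt_one (by linarith)]
      linarith
  have h1 : HasSum F ((1 - w) ^ (-a : ℂ) * gaussSeries a a (w / (w - 1))) := by
    rw [gaussSeries, ← tsum_mul_left, ← tsum_congr fun k => (hrow k).tsum_eq, ← hsum.tsum_prod]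
    exact hsum.hasSum
  have h2 := (Finset.HasAntidiagonal.sigmaAntidiagonalEquivProd.hasSum_iff.2 h1).sigma
    (fun n => hasSum_fintype _)
  rw [← h2.tsum_eq, gaussSeries]
  refine tsum_congr fun n => ?_
  change _ = ∑ b : Finset.HasAntidiagonal.antidiagonal n, F b
  rw [Finset.univ_eq_attach, Finset.sum_attach (Finset.HasAntidiagonal.antidiagonal n) (fun x => F x),
    gaussCoeff_eq_risingCoeff_mul, ← sum_antidiagonal_risingCoeff_mul_choose]
  push_cast
  rw [Finset.mul_sum, Finset.sum_mul]
  refine Finset.sum_congr rfl fun x hx => ?_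
  have hx' := Finset.HasAntidiagonal.mem_antidiagonal.1 hx
  have h3 := risingCoeff_mul_risingCoeff_add a x.1 x.2
  rw [hx'] at h3
  have h4 : (risingCoeff a x.1 : ℂ) * risingCoeff (a + x.1) x.2 = n.choose x.1 * risingCoeff a n := by
    exact_mod_cast h3
  simp only [F, gaussCoeff_eq_risingCoeff_mul]
  rw [neg_pow, show w ^ n = w ^ x.1 * w ^ x.2 by rw [← pow_add, hx']]
  push_cast
  linear_combination -(risingCoeff a x.1 * (-1) ^ x.1 * w ^ x.1 * w ^ x.2 : ℂ) * h4

/-! ### Appell's double series -/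

/-- The coefficients of Appell's double series `F₃(a, a; 1 - a, 1 - a; 1; x, y)`. -/
noncomputable def appellCoeff (a : ℝ) (n m : ℕ) : ℝ :=
  gaussCoeff a (1 - a) n * gaussCoeff a (1 - a) m *
    ((n.factorial : ℝ) * m.factorial / (n + m).factorial)

lemma abs_appellCoeff_le (a : ℝ) (n m : ℕ) :
    |appellCoeff a n m| ≤ |gaussCoeff a (1 - a) n| * |gaussCoeff a (1 - a) m| := by
  rw [appellCoeff, abs_mul, abs_mul]
  refine mul_le_of_le_one_right (by positivity) ?_
  rw [abs_of_nonneg (by positivity), div_le_one (by positivity)]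
  exact_mod_cast Nat.le_of_dvd (Nat.factorial_pos _) (Nat.factorial_mul_factorial_dvd_factorial_add n m)

lemma appellCoeff_zero_left (a : ℝ) (m : ℕ) : appellCoeff a 0 m = gaussCoeff a (1 - a) m := by
  have : (m.factorial : ℝ) ≠ 0 := by exact_mod_cast m.factorial_ne_zero
  simp [appellCoeff, gaussCoeff_zero, this]

/-- For A_n(z) = ∑ `appellCoeff a n m` z^m this reads (n + 1) A_{n+1} = (1 - z) A_n' + n A_n, which
is also the recurrence of (1 - z)^n g^(n)(z) / n! for any g. -/
lemma appellCoeff_succ_left (a : ℝ) (n m : ℕ) :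
    (n + 1) * appellCoeff a (n + 1) m =
      (m + 1) * appellCoeff a n (m + 1) - (m - n) * appellCoeff a n m := by
  have h1 : (n.factorial : ℝ) ≠ 0 := by exact_mod_cast n.factorial_ne_zero
  have h2 : (m.factorial : ℝ) ≠ 0 := by exact_mod_cast m.factorial_ne_zero
  have h3 : ((n + m).factorial : ℝ) ≠ 0 := by exact_mod_cast (n + m).factorial_ne_zero
  have h4 : (n : ℝ) + m + 1 ≠ 0 := by positivity
  simp only [appellCoeff, gaussCoeff_succ, show n + 1 + m = n + m + 1 by ring, ← add_assoc,
    Nat.factorial_succ]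
  push_cast
  field_simp
  ring

lemma polyGrowth_appellCoeff (a : ℝ) (n : ℕ) : PolyGrowth fun m => (appellCoeff a n m : ℂ) := by
  refine ((polyGrowth_gaussCoeff a (1 - a)).const_mul (gaussCoeff a (1 - a) n : ℂ)).mono_norm
    fun m => ?_
  simp only [norm_mul, norm_real, Real.norm_eq_abs]
  exact abs_appellCoeff_le a n m

/-- Summing over one index produces the Taylor coefficients of the Gauss function at z, scaled by (1
- z)^n. This is what makes the double series a Taylor expansion. -/
lemma tsum_appellCoeff (a : ℝ) (n : ℕ) {z : ℂ} (hz : ‖z‖ < 1) :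
    ∑' m, (appellCoeff a n m : ℂ) * z ^ m =
      (n.factorial : ℂ)⁻¹ * (1 - z) ^ n * iteratedDeriv n (gaussSeries a (1 - a)) z := by
  induction n generalizing z with
  | zero => simp [appellCoeff_zero_left, gaussSeries]
  | succ n ih =>
    have hg := polyGrowth_appellCoeff a n
    have hq : DifferentiableAt ℂ (iteratedDeriv n (gaussSeries a (1 - a))) z := by
      have h := ((differentiableOn_gaussSeries a (1 - a)).analyticOnNhd Metric.isOpen_ball).iterated_deriv n
      rw [iteratedDeriv_eq_iterate]
      exact (h z (mem_ball_zero_iff.2 hz)).differentiableAt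
    have h1 := hg.hasDerivAt hz
    have h2 : HasDerivAt (fun z => ∑' m, (appellCoeff a n m : ℂ) * z ^ m)
        ((n.factorial : ℂ)⁻¹ * (n * (1 - z) ^ (n - 1) * (-1)) *
          iteratedDeriv n (gaussSeries a (1 - a)) z + (n.factorial : ℂ)⁻¹ * (1 - z) ^ n *
            iteratedDeriv (n + 1) (gaussSeries a (1 - a)) z) z := by
      have h3 : HasDerivAt (fun z : ℂ => (1 - z) ^ n) (n * (1 - z) ^ (n - 1) * (-1)) z :=
        ((hasDerivAt_id z).const_sub 1).pow n
      have h4 := (h3.const_mul (n.factorial : ℂ)⁻¹).mul hq.hasDerivAt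
      rw [← iteratedDeriv_succ] at h4
      refine h4.congr_of_eventuallyEq ?_
      filter_upwards [Metric.isOpen_ball.mem_nhds (mem_ball_zero_iff.2 hz)] with y hy
      exact ih (mem_ball_zero_iff.1 hy)
    have h5 := h1.unique h2
    have hs1 := hg.succ_mul.summable hz
    have hs0 := hg.summable hz
    have hs2 : HasSum (fun m : ℕ => (m : ℂ) * appellCoeff a n m * z ^ m)
        (z * ∑' m : ℕ, ((m : ℂ) + 1) * appellCoeff a n (m + 1) * z ^ m) := by
      rw [← hasSum_nat_add_iff' 1]
      simp only [Finset.range_one, Finset.sum_singleton, Nat.cast_zero, zero_mul, sub_zero]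
      convert! hs1.hasSum.mul_left z using 2 with m
      push_cast; ring
    have h6 := ((hs1.hasSum.sub hs2).add (hs0.hasSum.mul_left (n : ℂ))).tsum_eq
    have h7 : ∑' m, (appellCoeff a (n + 1) m : ℂ) * z ^ m = ((n : ℂ) + 1)⁻¹ *
        ∑' m : ℕ, ((((m : ℂ) + 1) * appellCoeff a n (m + 1) * z ^ m - m * appellCoeff a n m * z ^ m)
          + n * (appellCoeff a n m * z ^ m)) := by
      rw [← tsum_mul_left]
      refine tsum_congr fun m => ?_
      have h8 : ((n : ℂ) + 1) * appellCoeff a (n + 1) m =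
          (m + 1) * appellCoeff a n (m + 1) - (m - n) * appellCoeff a n m := by
        exact_mod_cast appellCoeff_succ_left a n m
      have h9 : (n : ℂ) + 1 ≠ 0 := Nat.cast_add_one_ne_zero n
      rw [eq_inv_mul_iff_mul_eq₀ h9]
      linear_combination z ^ m * h8
    rw [h7, h6, h5, ih hz]
    have h9 : (n : ℂ) + 1 ≠ 0 := Nat.cast_add_one_ne_zero n
    have hf : (n.factorial : ℂ) ≠ 0 := by exact_mod_cast n.factorial_ne_zero
    have h10 : (n : ℂ) * ((1 - z) ^ (n - 1) * (1 - z)) = n * (1 - z) ^ n := by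
      cases n with
      | zero => simp
      | succ k => simp [pow_succ]
    rw [Nat.factorial_succ]
    push_cast
    field_simp
    linear_combination -(iteratedDeriv n (gaussSeries a (1 - a)) z) * h10

/-- Reduction of Appell's `F₃` to Gauss's function. -/
lemma hasSum_appellCoeff (a : ℝ) {x y : ℂ} (hx : ‖x‖ < 1 / 3) (hy : ‖y‖ < 1 / 3) :
    HasSum (fun i : ℕ × ℕ => (appellCoeff a i.1 i.2 : ℂ) * x ^ i.1 * y ^ i.2)
      (gaussSeries a (1 - a) (x + y - x * y)) := by
  have hx1 : ‖x‖ < 1 := by linarith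
  have hy1 : ‖y‖ < 1 := by linarith
  have hc := polyGrowth_gaussCoeff a (1 - a)
  have hs : Summable fun i : ℕ × ℕ => (appellCoeff a i.1 i.2 : ℂ) * x ^ i.1 * y ^ i.2 := by
    refine Summable.of_norm (Summable.of_nonneg_of_le (fun i => norm_nonneg _) (fun i => ?_)
      ((hc.summable_norm hx1).mul_of_nonneg (hc.summable_norm hy1) (fun i => norm_nonneg _)
        (fun i => norm_nonneg _)))
    simp only [norm_mul, norm_real, Real.norm_eq_abs, norm_pow]
    calc _ ≤ |gaussCoeff a (1 - a) i.1| * |gaussCoeff a (1 - a) i.2| * ‖x‖ ^ i.1 * ‖y‖ ^ i.2 := by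
          gcongr; exact abs_appellCoeff_le a _ _
      _ = _ := by ring
  -- Since x + y - xy = y + x(1 - y), the expansion is taken about y. The bounds 1/3 make the
  -- increment at most 4/9 < 2/3, and the ball of radius 2/3 about y stays in the unit disc.
  have h1 : ‖1 - y‖ ≤ 4 / 3 := (norm_sub_le _ _).trans (by rw [norm_one]; linarith)
  have hz : x + y - x * y ∈ Metric.ball y (2 / 3) := by
    rw [mem_ball_iff_norm, show x + y - x * y - y = x * (1 - y) by ring, norm_mul]
    nlinarith [norm_nonneg x, norm_nonneg (1 - y)]
  have hsub : Metric.ball y (2 / 3) ⊆ Metric.ball (0 : ℂ) 1 :=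
    Metric.ball_subset_ball' (by rw [dist_zero_right]; linarith)
  have hT := hasSum_taylorSeries_on_ball ((differentiableOn_gaussSeries a (1 - a)).mono hsub) hz
  rw [← hT.tsum_eq]
  have h2 : ∑' i : ℕ × ℕ, (appellCoeff a i.1 i.2 : ℂ) * x ^ i.1 * y ^ i.2 =
      ∑' n : ℕ, (n.factorial : ℂ)⁻¹ • (x + y - x * y - y) ^ n •
        iteratedDeriv n (gaussSeries a (1 - a)) y := by
    rw [hs.tsum_prod]
    refine tsum_congr fun n => ?_
    have h3 : ∀ m, (appellCoeff a n m : ℂ) * x ^ n * y ^ m = x ^ n * (appellCoeff a n m * y ^ m) :=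
      fun m => by ring
    simp only [h3]
    rw [tsum_mul_left, tsum_appellCoeff a n hy1, show x + y - x * y - y = x * (1 - y) by ring,
      mul_pow, smul_eq_mul, smul_eq_mul]
    ring
  rw [← h2]
  exact hs.hasSum

/-! ### Continuation of ₂F₁(a, 1 - a; 1; 1 - ρ) to ρ > 0 -/

/-- A neighbourhood of the positive half-line in the complex plane. -/
def legendreDomain : Set ℂ := {ρ | 1 / 2 < ρ.re} ∪ Metric.ball 1 1

open Classical in
/-- The function `₂F₁(a, 1 - a; 1; 1 - ρ)` on `legendreDomain`. -/
noncomputable def legendreFun (a : ℝ) (ρ : ℂ) : ℂ :=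
  if ρ ∈ Metric.ball (1 : ℂ) 1 then gaussSeries a (1 - a) (1 - ρ)
  else ρ ^ (-a : ℂ) * gaussSeries a a ((ρ - 1) / ρ)

lemma isOpen_half_lt_re : IsOpen {ρ : ℂ | 1 / 2 < ρ.re} :=
  isOpen_lt continuous_const continuous_re

lemma isOpen_legendreDomain : IsOpen legendreDomain := isOpen_half_lt_re.union Metric.isOpen_ball

lemma ne_zero_of_half_lt_re {ρ : ℂ} (h : 1 / 2 < ρ.re) : ρ ≠ 0 := by
  rintro rfl
  rw [zero_re] at h
  linarith

/-- The half-plane consists of the points closer to 1 than to 0. -/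
lemma norm_sub_one_div_lt_one {ρ : ℂ} (h : 1 / 2 < ρ.re) : ‖(ρ - 1) / ρ‖ < 1 := by
  have h0 := ne_zero_of_half_lt_re h
  rw [norm_div, div_lt_one (norm_pos_iff.2 h0)]
  refine lt_of_pow_lt_pow_left₀ 2 (norm_nonneg _) ?_
  rw [← normSq_eq_norm_sq, ← normSq_eq_norm_sq, normSq_apply, normSq_apply]
  simp only [sub_re, one_re, sub_im, one_im]
  nlinarith

lemma differentiableOn_cpow_mul_gaussSeries (a : ℝ) :
    DifferentiableOn ℂ (fun ρ : ℂ => ρ ^ (-a : ℂ) * gaussSeries a a ((ρ - 1) / ρ))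
      {ρ : ℂ | 1 / 2 < ρ.re} := by
  intro ρ hρ
  have hρ' : 1 / 2 < ρ.re := hρ
  have h0 := ne_zero_of_half_lt_re hρ
  have h1 : DifferentiableAt ℂ (gaussSeries a a) ((ρ - 1) / ρ) :=
    (differentiableOn_gaussSeries a a).differentiableAt
      (Metric.isOpen_ball.mem_nhds (mem_ball_zero_iff.2 (norm_sub_one_div_lt_one hρ)))
  have h2 : DifferentiableAt ℂ (fun ρ : ℂ => (ρ - 1) / ρ) ρ :=
    (differentiableAt_id.sub_const 1).div differentiableAt_id h0
  have h3 : DifferentiableAt ℂ (fun ρ : ℂ => ρ ^ (-a : ℂ)) ρ :=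
    differentiableAt_id.cpow_const (Or.inl (by change 0 < ρ.re; linarith))
  exact (h3.mul (DifferentiableAt.comp (g := gaussSeries a a)
    (f := fun ρ : ℂ => (ρ - 1) / ρ) ρ h1 h2)).differentiableWithinAt

lemma differentiableOn_gaussSeries_one_sub (a : ℝ) :
    DifferentiableOn ℂ (fun ρ : ℂ => gaussSeries a (1 - a) (1 - ρ)) (Metric.ball 1 1) := by
  refine (differentiableOn_gaussSeries a (1 - a)).comp
    (differentiableOn_id.const_sub 1) fun ρ hρ => ?_
  rw [mem_ball_zero_iff, norm_sub_rev]
  exact mem_ball_iff_norm.1 hρ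

/-- Pfaff's formula, known for |1 - ρ| < 1/2, spreads over the convex overlap by the identity
theorem. This makes the two branches of `legendreFun` agree. -/
lemma gaussSeries_one_sub_eq (a : ℝ) {ρ : ℂ} (h1 : ρ ∈ Metric.ball (1 : ℂ) 1) (h2 : 1 / 2 < ρ.re) :
    gaussSeries a (1 - a) (1 - ρ) = ρ ^ (-a : ℂ) * gaussSeries a a ((ρ - 1) / ρ) := by
  have hopen : IsOpen (Metric.ball (1 : ℂ) 1 ∩ {ρ : ℂ | 1 / 2 < ρ.re}) :=
    Metric.isOpen_ball.inter isOpen_half_lt_re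
  have hconv : Convex ℝ (Metric.ball (1 : ℂ) 1 ∩ {ρ : ℂ | 1 / 2 < ρ.re}) :=
    (convex_ball _ _).inter (convex_halfSpace_re_gt _)
  refine AnalyticOnNhd.eqOn_of_preconnected_of_eventuallyEq (z₀ := 1)
    (((differentiableOn_gaussSeries_one_sub a).mono inter_subset_left).analyticOnNhd hopen)
    (((differentiableOn_cpow_mul_gaussSeries a).mono inter_subset_right).analyticOnNhd hopen)
    hconv.isPreconnected ⟨Metric.mem_ball_self one_pos, by simp; norm_num⟩ ?_ ⟨h1, h2⟩
  filter_upwards [Metric.ball_mem_nhds (1 : ℂ) (by norm_num : (0 : ℝ) < 1 / 2)] with z hz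
  rw [gaussSeries_pfaff a (w := 1 - z) (by rw [norm_sub_rev]; exact mem_ball_iff_norm.1 hz)]
  rw [sub_sub_cancel, show (1 - z) / (1 - z - 1) = (z - 1) / z by
    rw [show 1 - z - 1 = -z by ring, div_neg, ← neg_div, neg_sub]]

lemma legendreFun_of_mem_ball (a : ℝ) {ρ : ℂ} (h : ρ ∈ Metric.ball (1 : ℂ) 1) :
    legendreFun a ρ = gaussSeries a (1 - a) (1 - ρ) := if_pos h

lemma legendreFun_of_half_lt_re (a : ℝ) {ρ : ℂ} (h : 1 / 2 < ρ.re) :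
    legendreFun a ρ = ρ ^ (-a : ℂ) * gaussSeries a a ((ρ - 1) / ρ) := by
  by_cases h1 : ρ ∈ Metric.ball (1 : ℂ) 1
  · rw [legendreFun_of_mem_ball a h1, gaussSeries_one_sub_eq a h1 h]
  · exact if_neg h1

lemma differentiableOn_legendreFun (a : ℝ) : DifferentiableOn ℂ (legendreFun a) legendreDomain := by
  rintro ρ (h | h)
  · refine (((differentiableOn_cpow_mul_gaussSeries a).differentiableAt
      (isOpen_half_lt_re.mem_nhds h)).congr_of_eventuallyEq ?_).differentiableWithinAt
    filter_upwards [isOpen_half_lt_re.mem_nhds h] with z hz using legendreFun_of_half_lt_re a hz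
  · refine (((differentiableOn_gaussSeries_one_sub a).differentiableAt
      (Metric.isOpen_ball.mem_nhds h)).congr_of_eventuallyEq ?_).differentiableWithinAt
    filter_upwards [Metric.isOpen_ball.mem_nhds h] with z hz using legendreFun_of_mem_ball a hz

lemma ofReal_mem_ball_one {ρ : ℝ} (h0 : 0 < ρ) (h1 : ρ < 2) : (ρ : ℂ) ∈ Metric.ball (1 : ℂ) 1 := by
  rw [mem_ball_iff_norm, ← ofReal_one, ← ofReal_sub, norm_real, Real.norm_eq_abs, abs_lt]
  constructor <;> linarith

lemma ofReal_mem_legendreDomain {ρ : ℝ} (h : 0 < ρ) : (ρ : ℂ) ∈ legendreDomain := by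
  rcases lt_or_ge ρ 2 with h1 | h1
  · exact Or.inr (ofReal_mem_ball_one h h1)
  · refine Or.inl ?_
    change 1 / 2 < (ρ : ℂ).re
    rw [ofReal_re]; linarith

lemma legendreFun_one (a : ℝ) : legendreFun a 1 = 1 := by
  rw [legendreFun_of_mem_ball a (Metric.mem_ball_self one_pos), sub_self, gaussSeries_zero]

lemma legendreFun_ofReal_of_lt_two (a : ℝ) {ρ : ℝ} (h0 : 0 < ρ) (h1 : ρ < 2) :
    legendreFun a ρ = ((∑' k, gaussCoeff a (1 - a) k * (1 - ρ) ^ k : ℝ) : ℂ) := by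
  rw [legendreFun_of_mem_ball a (ofReal_mem_ball_one h0 h1), ← gaussSeries_ofReal]
  push_cast; rfl

lemma legendreFun_ofReal_of_half_lt (a : ℝ) {ρ : ℝ} (h : 1 / 2 < ρ) :
    legendreFun a ρ = ((ρ ^ (-a) * ∑' k, gaussCoeff a a k * (1 - 1 / ρ) ^ k : ℝ) : ℂ) := by
  have h0 : (ρ : ℂ) ≠ 0 := by exact_mod_cast (by linarith : (0 : ℝ) < ρ).ne'
  rw [legendreFun_of_half_lt_re a (by rwa [ofReal_re]), ofReal_mul, ← gaussSeries_ofReal,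
    ofReal_cpow (by linarith), sub_div, div_self h0]
  push_cast; rfl

lemma legendreFun_ofReal_re (a : ℝ) {ρ : ℝ} (h : 0 < ρ) :
    ((legendreFun a ρ).re : ℂ) = legendreFun a ρ := by
  rcases lt_or_ge ρ 2 with h1 | h1
  · rw [legendreFun_ofReal_of_lt_two a h h1, ofReal_re]
  · rw [legendreFun_ofReal_of_half_lt a (by linarith), ofReal_re]

lemma legendreFun_ofReal_pos (a : ℝ) {ρ : ℝ} (h : 1 ≤ ρ) : 0 < (legendreFun a ρ).re := by
  rw [legendreFun_ofReal_of_half_lt a (by linarith), ofReal_re]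
  have h1 : 1 / ρ ≤ 1 := by rw [div_le_one (by linarith)]; exact h
  have h2 : 0 < 1 / ρ := by positivity
  have := one_le_tsum_gaussCoeff_self a (x := 1 - 1 / ρ) (by linarith) (by linarith)
  have h3 : 0 < ρ ^ (-a) := Real.rpow_pos_of_pos (by linarith) _
  exact mul_pos h3 (by linarith)

lemma exists_legendreFun_ofReal_le (a : ℝ) : ∃ C s : ℝ, 0 ≤ C ∧ ∀ ρ : ℝ, 1 ≤ ρ →
    |(legendreFun a ρ).re| ≤ C * ρ ^ s := by
  obtain ⟨C, N, hC, h⟩ := exists_tsum_gaussCoeff_self_le a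
  refine ⟨C, -a + N, hC, fun ρ hρ => ?_⟩
  rw [abs_of_pos (legendreFun_ofReal_pos a hρ), legendreFun_ofReal_of_half_lt a (by linarith),
    ofReal_re]
  have h1 : 1 / ρ ≤ 1 := by rw [div_le_one (by linarith)]; exact hρ
  have h2 : 0 < 1 / ρ := by positivity
  have h3 := h (1 - 1 / ρ) (by linarith) (by linarith)
  rw [sub_sub_cancel, one_div_one_div] at h3
  have h4 : 0 < ρ ^ (-a) := Real.rpow_pos_of_pos (by linarith) _
  rw [Real.rpow_add (by linarith), Real.rpow_natCast]
  calc _ ≤ ρ ^ (-a) * (C * ρ ^ N) := by gcongr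
    _ = _ := by ring

/-- The Gauss coefficients are symmetric in a and 1 - a. With a = |ν| + 1/2 this allows |ν| to be
replaced by ν. -/
lemma legendreFun_comm (a : ℝ) {ρ : ℝ} (h0 : 0 < ρ) (h1 : ρ < 2) :
    legendreFun (1 - a) ρ = legendreFun a ρ := by
  rw [legendreFun_ofReal_of_lt_two _ h0 h1, legendreFun_ofReal_of_lt_two _ h0 h1,
    gaussCoeff_comm (1 - a), sub_sub_cancel]

/-! ### Comparison with the continued ₂F₁(a, a; 1; z) -/

/-- Pfaff's formula solved for ₂F₁(a, a; 1; z), with ρ = 1/(1 - z) > 0 for z < 1. It supplies the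
continuation whose existence the choice in `hypergeometricF` requires. -/
lemma analyticOnNhd_legendreFun_inv (a : ℝ) : AnalyticOnNhd ℝ
    (fun z : ℝ => (((1 - z : ℂ)⁻¹) ^ (a : ℂ) * legendreFun a (1 - z : ℂ)⁻¹).re) (Iio 1) := by
  intro z hz
  have hz' : 0 < 1 - z := sub_pos.2 hz
  have e : ((1 - z : ℂ)⁻¹) = (((1 - z)⁻¹ : ℝ) : ℂ) := by push_cast; rfl
  have h0 : (1 - z : ℂ) ≠ 0 := by exact_mod_cast hz'.ne'
  have h1 : AnalyticAt ℂ (fun z : ℂ => (1 - z)⁻¹) z :=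
    (analyticAt_const.sub analyticAt_id).inv h0
  have hpos : 0 < (1 - z)⁻¹ := inv_pos.2 hz'
  have h2 : AnalyticAt ℂ (legendreFun a) ((1 - z : ℂ)⁻¹) := by
    rw [e]
    exact (differentiableOn_legendreFun a).analyticAt
      (isOpen_legendreDomain.mem_nhds (ofReal_mem_legendreDomain hpos))
  have h3 : AnalyticAt ℂ (fun z : ℂ => ((1 - z)⁻¹) ^ (a : ℂ) * legendreFun a (1 - z)⁻¹) z := by
    refine (h1.cpow analyticAt_const ?_).mul (AnalyticAt.comp (g := legendreFun a)
      (f := fun z : ℂ => (1 - z)⁻¹) h2 h1)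
    rw [e]
    exact Or.inl (by rw [ofReal_re]; exact hpos)
  exact h3.re_ofReal

lemma legendreFun_inv_eq_ordinaryHypergeometric (a : ℝ) {z : ℝ} (hz : z ∈ Ioo (-1 : ℝ) 1) :
    (((1 - z : ℂ)⁻¹) ^ (a : ℂ) * legendreFun a (1 - z : ℂ)⁻¹).re
      = ordinaryHypergeometric a a 1 z := by
  have h1 : 0 < 1 - z := by linarith [hz.2]
  have hpos : 0 < (1 - z)⁻¹ := inv_pos.2 h1
  have h2 : 1 / 2 < (1 - z)⁻¹ := by
    rw [one_div]; exact inv_strictAnti₀ h1 (by linarith [hz.1])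
  have e : ((1 - z : ℂ)⁻¹) = (((1 - z)⁻¹ : ℝ) : ℂ) := by push_cast; rfl
  rw [e, legendreFun_ofReal_of_half_lt a h2, ← ofReal_cpow hpos.le, ← ofReal_mul, ofReal_re,
    ← mul_assoc, ← Real.rpow_add hpos, add_neg_cancel, Real.rpow_zero, one_mul,
    ordinaryHypergeometric_one_eq_tsum, one_div, inv_inv, sub_sub_cancel]

lemma hypergeometricF_spec (a : ℝ) : AnalyticOnNhd ℝ (hypergeometricF a a 1) (Iio 1) ∧
    ∀ z ∈ Ioo (-1 : ℝ) 1, hypergeometricF a a 1 z = ordinaryHypergeometric a a 1 z :=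
  Classical.epsilon_spec (p := fun G : ℝ → ℝ => AnalyticOnNhd ℝ G (Iio 1) ∧
    ∀ z ∈ Ioo (-1 : ℝ) 1, G z = ordinaryHypergeometric a a 1 z)
    ⟨_, analyticOnNhd_legendreFun_inv a, fun _ => legendreFun_inv_eq_ordinaryHypergeometric a⟩

lemma hypergeometricF_eq_legendreFun (a : ℝ) {z : ℝ} (hz : z < 1) :
    hypergeometricF a a 1 z = (1 - z)⁻¹ ^ a * (legendreFun a ((1 - z)⁻¹ : ℝ)).re := by
  have h := AnalyticOnNhd.eqOn_of_preconnected_of_eventuallyEq (hypergeometricF_spec a).1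
    (analyticOnNhd_legendreFun_inv a) isPreconnected_Iio (z₀ := 0) (mem_Iio.2 one_pos) ?_ hz
  · have e : ((1 - z : ℂ)⁻¹) = (((1 - z)⁻¹ : ℝ) : ℂ) := by push_cast; rfl
    have hpos : 0 < (1 - z)⁻¹ := inv_pos.2 (by linarith)
    rw [h]
    simp only [e]
    rw [← ofReal_cpow hpos.le, re_ofReal_mul]
  · filter_upwards [Ioo_mem_nhds (by norm_num : (-1 : ℝ) < 0) one_pos] with y hy
    rw [(hypergeometricF_spec a).2 y hy, legendreFun_inv_eq_ordinaryHypergeometric a hy]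

lemma legendreFun_eq_hypergeometricF (a : ℝ) {ρ : ℝ} (h : 0 < ρ) :
    (legendreFun a ρ).re = ρ ^ (-a) * hypergeometricF a a 1 (1 - 1 / ρ) := by
  have h1 : 0 < 1 / ρ := by positivity
  rw [hypergeometricF_eq_legendreFun a (by linarith), sub_sub_cancel, one_div, inv_inv, ← mul_assoc,
    ← Real.rpow_add h, neg_add_cancel, Real.rpow_zero, one_mul]

lemma hypergeometricF_zero (a : ℝ) : hypergeometricF a a 1 0 = 1 := by
  rw [(hypergeometricF_spec a).2 0 (by norm_num), ordinaryHypergeometric_zero]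

/-- Right of the largest negative zero, the hypergeometric function is nonnegative. -/
lemma hypergeometricF_nonneg (ν : ℝ) {z : ℝ} (hz0 : z < 0) (hz : largestNegativeZero ν ≤ z) :
    0 ≤ hypergeometricF (ν + 1 / 2) (ν + 1 / 2) 1 z := by
  by_contra! hneg
  have hcont : ContinuousOn (hypergeometricF (ν + 1 / 2) (ν + 1 / 2) 1) (Icc z 0) :=
    (hypergeometricF_spec _).1.continuousOn.mono fun y hy => lt_of_le_of_lt hy.2 one_pos
  obtain ⟨y, hy, hy0⟩ := intermediate_value_Ioo hz0.le hcont
    (show (0 : ℝ) ∈ Ioo _ _ from ⟨hneg, by rw [hypergeometricF_zero]; exact one_pos⟩)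
  have h1 : (y : EReal) ≤ largestNegativeZero ν := le_sSup ⟨y, ⟨hy.2, hy0⟩, rfl⟩
  exact absurd (h1.trans hz) (by rw [not_le]; exact_mod_cast hy.1)

/-! ### Parameter integrals and beta integrals -/

/-- A weighted integral over `[0, 1]` of functions holomorphic in a parameter is holomorphic. -/
lemma differentiableOn_integral_weight {w : ℝ → ℂ} (hw : IntervalIntegrable w volume 0 1)
    {g : ℝ → ℂ → ℂ} {U : Set ℂ} (hU : IsOpen U)
    (hc : ContinuousOn (fun p : ℝ × ℂ => g p.1 p.2) (Icc 0 1 ×ˢ U))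
    (hd : ∀ s ∈ Icc (0 : ℝ) 1, DifferentiableOn ℂ (g s) U) :
    DifferentiableOn ℂ (fun z => ∫ s in (0 : ℝ)..1, w s * g s z) U := by
  intro z₀ hz₀
  obtain ⟨R, hR, hRU⟩ := Metric.nhds_basis_closedBall.mem_iff.1 (hU.mem_nhds hz₀)
  -- Circles of radius r about points of the ball of radius r stay in the closed ball of radius R,
  -- where g is bounded by B; Cauchy's estimate then gives the dominating constant B / r.
  obtain ⟨r, hr, hrR⟩ : ∃ r, 0 < r ∧ r + r ≤ R := ⟨R / 2, by linarith, by linarith⟩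
  have hcomp : IsCompact (Icc (0 : ℝ) 1 ×ˢ Metric.closedBall z₀ R) :=
    isCompact_Icc.prod (isCompact_closedBall _ _)
  obtain ⟨B, hB⟩ := hcomp.exists_bound_of_continuousOn (hc.mono (prod_mono_right hRU))
  have hw' : IntegrableOn w (Ioc 0 1) := (intervalIntegrable_iff_integrableOn_Ioc_of_le zero_le_one).1 hw
  have hmeas : ∀ z ∈ U, AEStronglyMeasurable (fun s => w s * g s z) (volume.restrict (Ioc 0 1)) :=
    fun z hz => by
      refine hw'.aestronglyMeasurable.mul (ContinuousOn.aestronglyMeasurable ?_ measurableSet_Ioc)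
      exact (hc.comp (by fun_prop : ContinuousOn (fun s : ℝ => (s, z)) (Icc 0 1))
        fun s hs => ⟨hs, hz⟩).mono Ioc_subset_Icc_self
  have hdiff : ∀ s ∈ Icc (0 : ℝ) 1, ∀ z ∈ U, DifferentiableAt ℂ (g s) z := fun s hs z hz =>
    (hd s hs).differentiableAt (hU.mem_nhds hz)
  have hbound : ∀ s ∈ Icc (0 : ℝ) 1, ∀ z ∈ Metric.ball z₀ r, ‖deriv (g s) z‖ ≤ B / r := by
    intro s hs z hz
    have hsub : Metric.closedBall z r ⊆ Metric.closedBall z₀ R :=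
      Metric.closedBall_subset_closedBall' (by linarith [(Metric.mem_ball.1 hz).le])
    refine norm_deriv_le_of_forall_mem_sphere_norm_le hr
      (((hd s hs).mono (hsub.trans hRU)).diffContOnCl_ball Subset.rfl) fun y hy => ?_
    exact hB (s, y) ⟨hs, hsub (Metric.sphere_subset_closedBall hy)⟩
  have hballU : Metric.ball z₀ r ⊆ U := (Metric.ball_subset_closedBall.trans
    (Metric.closedBall_subset_closedBall (by linarith))).trans hRU
  have hderiv_meas : AEStronglyMeasurable (fun s => w s * deriv (g s) z₀)
      (volume.restrict (Ioc 0 1)) := by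
    -- The derivative in z is measurable in s as a limit of difference quotients along this
    -- sequence.
    let u : ℕ → ℂ := fun n => z₀ + (((r / 2) * (1 / 2) ^ n : ℝ) : ℂ)
    have hpos : ∀ n : ℕ, 0 < (r / 2) * (1 / 2 : ℝ) ^ n := fun n => by positivity
    have hu : ∀ n, u n ∈ U := fun n => hballU <| by
      rw [mem_ball_iff_norm, add_sub_cancel_left, norm_real, Real.norm_of_nonneg (hpos n).le]
      have : (1 / 2 : ℝ) ^ n ≤ 1 := pow_le_one₀ (by norm_num) (by norm_num)
      nlinarith
    have hulim : Tendsto u atTop (𝓝[≠] z₀) := by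
      refine tendsto_nhdsWithin_iff.2 ⟨?_, Eventually.of_forall fun n => ?_⟩
      · have h1 := (tendsto_pow_atTop_nhds_zero_of_lt_one (by norm_num : (0 : ℝ) ≤ 1 / 2)
          (by norm_num)).const_mul (r / 2)
        have h2 := ((continuous_ofReal.tendsto _).comp h1).const_add z₀
        simpa [u, Function.comp_def] using h2
      · simp only [u, mem_compl_iff, mem_singleton_iff, add_eq_left, ofReal_eq_zero]
        exact (hpos n).ne'
    refine aestronglyMeasurable_of_tendsto_ae atTop
      (f := fun n s => (u n - z₀)⁻¹ * (w s * g s (u n) - w s * g s z₀)) (fun n => ?_) ?_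
    · exact aestronglyMeasurable_const.mul ((hmeas _ (hu n)).sub (hmeas _ hz₀))
    · filter_upwards [ae_restrict_mem measurableSet_Ioc] with s hs
      have h1 := (hasDerivAt_iff_tendsto_slope.1
        (hdiff s (Ioc_subset_Icc_self hs) z₀ hz₀).hasDerivAt).comp hulim
      refine (h1.const_mul (w s)).congr fun n => ?_
      simp only [Function.comp, slope_def_field, div_eq_inv_mul]
      ring
  have key := hasDerivAt_integral_of_dominated_loc_of_deriv_le (μ := volume.restrict (Ioc (0 : ℝ) 1))
    (F := fun z s => w s * g s z) (F' := fun z s => w s * deriv (g s) z)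
    (bound := fun s => ‖w s‖ * (B / r)) (Metric.ball_mem_nhds z₀ hr)
    (by filter_upwards [hU.mem_nhds hz₀] with z hz using hmeas z hz)
    (by
      refine Integrable.mono' (hw'.norm.mul_const B) (hmeas z₀ hz₀) ?_
      filter_upwards [ae_restrict_mem measurableSet_Ioc] with s hs
      rw [norm_mul]
      gcongr
      exact hB (s, z₀) ⟨Ioc_subset_Icc_self hs, Metric.mem_closedBall_self hR.le⟩)
    hderiv_meas
    (by
      filter_upwards [ae_restrict_mem measurableSet_Ioc] with s hs z hz
      rw [norm_mul]
      gcongr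
      exact hbound s (Ioc_subset_Icc_self hs) z hz)
    (hw'.norm.mul_const _)
    (by
      filter_upwards [ae_restrict_mem measurableSet_Ioc] with s hs z hz
      exact (hdiff s (Ioc_subset_Icc_self hs) z (hballU hz)).hasDerivAt.const_mul _)
  simp only [intervalIntegral.integral_of_le (zero_le_one' ℝ)]
  exact key.2.differentiableAt.differentiableWithinAt

/-- Termwise integration against a weight of a series converging normally on `[0, 1]`. -/
lemma hasSum_integral_weight {ι : Type*} [Countable ι] {w : ℝ → ℂ}
    (hw : IntervalIntegrable w volume 0 1) {F : ι → ℝ → ℂ} {b : ι → ℝ} {f : ℝ → ℂ}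
    (hF : ∀ i, Continuous (F i)) (hb : Summable b) (hbd : ∀ i, ∀ s ∈ Icc (0 : ℝ) 1, ‖F i s‖ ≤ b i)
    (hf : ∀ s ∈ Icc (0 : ℝ) 1, HasSum (fun i => F i s) (f s)) :
    HasSum (fun i => ∫ s in (0 : ℝ)..1, w s * F i s) (∫ s in (0 : ℝ)..1, w s * f s) := by
  have hsub : ∀ s ∈ uIoc (0 : ℝ) 1, s ∈ Icc (0 : ℝ) 1 := fun s hs => by
    rw [uIoc_of_le zero_le_one] at hs
    exact Ioc_subset_Icc_self hs
  refine intervalIntegral.hasSum_integral_of_dominated_convergence (fun i s => ‖w s‖ * b i)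
    (fun i => hw.def'.aestronglyMeasurable.mul (hF i).aestronglyMeasurable)
    (fun i => Eventually.of_forall fun s hs => ?_) (Eventually.of_forall fun s _ => hb.mul_left _)
    ?_ (Eventually.of_forall fun s hs => (hf s (hsub s hs)).mul_left _)
  · rw [norm_mul]
    gcongr
    exact hbd i s (hsub s hs)
  · simp only [tsum_mul_left]
    exact hw.norm.mul_const _

/-- The integrand of the beta integral. -/
noncomputable def betaWeight (u v : ℂ) (s : ℝ) : ℂ := (s : ℂ) ^ (u - 1) * (1 - (s : ℂ)) ^ (v - 1)

lemma intervalIntegrable_betaWeight {u v : ℂ} (hu : 0 < u.re) (hv : 0 < v.re) :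
    IntervalIntegrable (betaWeight u v) volume 0 1 := betaIntegral_convergent hu hv

lemma integral_betaWeight_mul (u v : ℂ) (m n : ℕ) :
    ∫ s in (0 : ℝ)..1, betaWeight u v s * ((s : ℂ) ^ m * (1 - (s : ℂ)) ^ n) =
      betaIntegral (u + m) (v + n) := by
  rw [betaIntegral]
  refine intervalIntegral.integral_congr_Ioo_of_le zero_le_one fun s hs => ?_
  have h1 : (s : ℂ) ≠ 0 := by exact_mod_cast hs.1.ne'
  have h2 : (1 - (s : ℂ)) ≠ 0 := by exact_mod_cast (sub_pos.2 hs.2).ne'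
  simp only [betaWeight]
  rw [show u + m - 1 = u - 1 + m by ring, show v + n - 1 = v - 1 + n by ring, cpow_add _ _ h1,
    cpow_add _ _ h2, cpow_natCast, cpow_natCast]
  ring

lemma Gamma_add_natCast {a : ℝ} (ha : 0 < a) (n : ℕ) :
    Gamma (a + n) = Gamma a * (risingCoeff a n * n.factorial : ℝ) := by
  have h := Gamma_add_nat_div_Gamma_eq (n := n) (a : ℂ) fun k hk => by
    have : a = -(k : ℝ) := by exact_mod_cast hk
    have : (0 : ℝ) ≤ k := Nat.cast_nonneg k
    linarith
  have hf : (n.factorial : ℝ) ≠ 0 := by exact_mod_cast n.factorial_ne_zero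
  have h2 : (risingCoeff a n * n.factorial : ℝ) = (ascPochhammer ℝ n).eval a := by
    rw [risingCoeff]; field_simp
  have h3 : Gamma a ≠ 0 := Gamma_ne_zero_of_re_pos (by simpa using ha)
  have h4 : (ascPochhammer ℂ n).eval (a : ℂ) = ((ascPochhammer ℝ n).eval a : ℝ) := by
    clear h h2 hf
    induction n with
    | zero => simp
    | succ n ih => simp only [ascPochhammer_succ_eval, ih]; push_cast; rfl
  rw [h2, ← h4, ← h]
  field_simp

lemma betaIntegral_eq_Gamma_div {u v : ℂ} (hu : 0 < u.re) (hv : 0 < v.re) :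
    betaIntegral u v = Gamma u * Gamma v / Gamma (u + v) := by
  rw [Gamma_mul_Gamma_eq_betaIntegral hu hv, mul_div_cancel_left₀]
  exact Gamma_ne_zero_of_re_pos (by rw [add_re]; linarith)

/-- After the beta integrals become Gamma quotients both sides agree. This matches the (m, n)
coefficients in `integral_convKernel_eq`; the factor 1 / (2a + m + n) is the beta integral with
second parameter 1. -/
lemma betaIntegral_mul_eq_appellCoeff {a : ℝ} (ha : 0 < a) (m n : ℕ) :
    (risingCoeff (1 - a) m : ℂ) * risingCoeff (1 - a) n *
        betaIntegral (a + m) (a + n) * (1 / (2 * a + (m + n : ℕ))) =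
      Gamma a ^ 2 / Gamma (2 * a) *
        (appellCoeff a m n * betaIntegral (1 + (m + n : ℕ)) (2 * a)) := by
  have hm : (0 : ℝ) ≤ m := Nat.cast_nonneg m
  have hn : (0 : ℝ) ≤ n := Nat.cast_nonneg n
  have h2 : (2 : ℂ) * a = ((2 * a : ℝ) : ℂ) := by push_cast; rfl
  have hre : 0 < ((2 : ℂ) * a + (m + n : ℕ)).re := by
    rw [h2, ← ofReal_natCast, ← ofReal_add, ofReal_re]; positivity
  have hk : (0 : ℝ) ≤ (m + n : ℕ) := Nat.cast_nonneg _
  rw [betaIntegral_eq_Gamma_div (by rw [← ofReal_natCast, ← ofReal_add, ofReal_re]; positivity)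
      (by rw [← ofReal_natCast, ← ofReal_add, ofReal_re]; positivity),
    betaIntegral_eq_Gamma_div (by rw [← ofReal_natCast, ← ofReal_one, ← ofReal_add, ofReal_re]; positivity)
      (by rw [h2, ofReal_re]; positivity),
    Gamma_add_natCast ha, Gamma_add_natCast ha, add_comm (1 : ℂ), Gamma_nat_eq_factorial,
    show (a : ℂ) + m + (a + n) = 2 * a + (m + n : ℕ) by push_cast; ring,
    show ((m + n : ℕ) : ℂ) + 1 + 2 * a = 2 * a + (m + n : ℕ) + 1 by ring,
    Gamma_add_one _ (by intro h; rw [h] at hre; simp at hre)]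
  have h3 : Gamma ((2 : ℂ) * a + (m + n : ℕ)) ≠ 0 := Gamma_ne_zero_of_re_pos hre
  have h4 : Gamma ((2 : ℂ) * a) ≠ 0 := Gamma_ne_zero_of_re_pos (by rw [h2, ofReal_re]; positivity)
  have h5 : (2 : ℂ) * a + (m + n : ℕ) ≠ 0 := by intro h; rw [h] at hre; simp at hre
  have h6 : ((m + n).factorial : ℂ) ≠ 0 := by exact_mod_cast (m + n).factorial_ne_zero
  rw [appellCoeff, gaussCoeff_eq_risingCoeff_mul, gaussCoeff_eq_risingCoeff_mul]
  push_cast at h3 h5 ⊢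
  field_simp

/-! ### The convolution kernel and the hypergeometric kernel -/

/-- The parameters `z` for which the kernels below are holomorphic. -/
def kernelDomain (α β : ℂ) : Set ℂ := {z | ∀ s ∈ Icc (0 : ℝ) 1, 1 + α * (s * z) ∈ slitPlane ∧
  1 + β * (s * z) ∈ slitPlane ∧ (1 + α * (s * z)) * (1 + β * (s * z)) ∈ legendreDomain}

lemma isOpen_kernelDomain (α β : ℂ) : IsOpen (kernelDomain α β) := by
  refine isOpen_iff_mem_nhds.2 fun z hz => ?_
  refine isCompact_Icc.eventually_forall_of_forall_eventually
    (P := fun (z : ℂ) (s : ℝ) => 1 + α * (s * z) ∈ slitPlane ∧ 1 + β * (s * z) ∈ slitPlane ∧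
      (1 + α * (s * z)) * (1 + β * (s * z)) ∈ legendreDomain) fun s hs => ?_
  obtain ⟨h1, h2, h3⟩ := hz s hs
  have c1 : Continuous fun p : ℂ × ℝ => 1 + α * (p.2 * p.1) := by fun_prop
  have c2 : Continuous fun p : ℂ × ℝ => 1 + β * (p.2 * p.1) := by fun_prop
  filter_upwards [c1.continuousAt.preimage_mem_nhds (isOpen_slitPlane.mem_nhds h1),
    c2.continuousAt.preimage_mem_nhds (isOpen_slitPlane.mem_nhds h2),
    (c1.mul c2).continuousAt.preimage_mem_nhds (isOpen_legendreDomain.mem_nhds h3)]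
    with p g1 g2 g3 using ⟨g1, g2, g3⟩

lemma zero_mem_kernelDomain (α β : ℂ) : 0 ∈ kernelDomain α β := fun s _ => by
  simp only [mul_zero, add_zero, mul_one]
  exact ⟨one_mem_slitPlane, one_mem_slitPlane, Or.inr (Metric.mem_ball_self one_pos)⟩

lemma ofReal_mul_mem_kernelDomain {α β : ℂ} {z : ℂ} (hz : z ∈ kernelDomain α β) {s : ℝ}
    (hs : s ∈ Icc (0 : ℝ) 1) : s * z ∈ kernelDomain α β := fun r hr => by
  have := hz (r * s) ⟨mul_nonneg hr.1 hs.1, mul_le_one₀ hr.2 hs.1 hs.2⟩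
  rw [ofReal_mul, mul_assoc] at this
  exact this

/-- Quantifying over all s in [0, 1] makes the domain star-shaped about 0. -/
lemma isPreconnected_kernelDomain (α β : ℂ) : IsPreconnected (kernelDomain α β) := by
  have : StarConvex ℝ 0 (kernelDomain α β) := starConvex_zero_iff.2 fun z hz s h0 h1 => by
    rw [real_smul]
    exact ofReal_mul_mem_kernelDomain hz ⟨h0, h1⟩
  exact (this.isPathConnected (zero_mem_kernelDomain α β)).isConnected.isPreconnected

lemma one_add_mul_ofReal_mem_slitPlane {α : ℂ} (hα : α ∈ slitPlane) {t : ℝ} (ht : 0 ≤ t) :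
    1 + α * t ∈ slitPlane := by
  rcases hα with h | h
  · refine Or.inl ?_
    simp only [add_re, one_re, re_mul_ofReal]
    positivity
  · rcases ht.eq_or_lt with rfl | h1
    · simp
    · refine Or.inr ?_
      simp only [add_im, one_im, im_mul_ofReal, zero_add]
      exact mul_ne_zero h h1.ne'

lemma one_add_mul_one_add_conj (α : ℂ) (t : ℝ) :
    (1 + α * t) * (1 + (starRingEnd ℂ) α * t) = ((normSq (1 + α * t) : ℝ) : ℂ) := by
  rw [normSq_eq_conj_mul_self]
  simp [mul_comm]

/-- For conjugate parameters the product of the two factors is |1 + αst|² > 0, so the domain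
contains the whole half-line. -/
lemma ofReal_mem_kernelDomain {α : ℂ} (hα : α ∈ slitPlane) {t : ℝ} (ht : 0 ≤ t) :
    (t : ℂ) ∈ kernelDomain α ((starRingEnd ℂ) α) := fun s hs => by
  have h0 : 0 ≤ s * t := mul_nonneg hs.1 ht
  have h1 := one_add_mul_ofReal_mem_slitPlane hα h0
  have hα' : (starRingEnd ℂ) α ∈ slitPlane := by
    rcases hα with h | h
    · exact Or.inl (by simpa using h)
    · exact Or.inr (by simpa using h)
  rw [← ofReal_mul]
  refine ⟨h1, one_add_mul_ofReal_mem_slitPlane hα' h0, ?_⟩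
  rw [one_add_mul_one_add_conj]
  exact ofReal_mem_legendreDomain (normSq_pos.2 (slitPlane_ne_zero h1))

/-- The convolution of `t ^ (a - 1) * (1 + α t) ^ (a - 1)` and `t ^ (a - 1) * (1 + β t) ^ (a - 1)`
at `z`, divided by `z ^ (2 * a - 1)`. -/
noncomputable def convKernel (a : ℝ) (α β z : ℂ) : ℂ := ∫ s in (0 : ℝ)..1, betaWeight a a s *
  ((1 + α * (s * z)) ^ (a - 1 : ℂ) * (1 + β * ((1 - s : ℝ) * z)) ^ (a - 1 : ℂ))

/-- The hypergeometric kernel `₂F₁(a, 1 - a; 1; 1 - (1 + α z) (1 + β z))`. -/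
noncomputable def legendreKernel (a : ℝ) (α β z : ℂ) : ℂ :=
  legendreFun a ((1 + α * z) * (1 + β * z))

lemma one_sub_mem_Icc {s : ℝ} (hs : s ∈ Icc (0 : ℝ) 1) : 1 - s ∈ Icc (0 : ℝ) 1 :=
  ⟨by linarith [hs.2], by linarith [hs.1]⟩

lemma differentiableOn_convKernel {a : ℝ} (ha : 0 < a) (α β : ℂ) :
    DifferentiableOn ℂ (convKernel a α β) (kernelDomain α β) := by
  refine differentiableOn_integral_weight (g := fun s z =>
    (1 + α * (s * z)) ^ (a - 1 : ℂ) * (1 + β * ((1 - s : ℝ) * z)) ^ (a - 1 : ℂ))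
    (intervalIntegrable_betaWeight (by simpa using ha) (by simpa using ha))
    (isOpen_kernelDomain α β) ?_ fun s hs => ?_
  · refine ContinuousOn.mul (ContinuousOn.cpow (by fun_prop) continuousOn_const fun p hp => ?_)
      (ContinuousOn.cpow (by fun_prop) continuousOn_const fun p hp => ?_)
    · exact (hp.2 p.1 hp.1).1
    · exact (hp.2 _ (one_sub_mem_Icc hp.1)).2.1
  · exact DifferentiableOn.mul
      (DifferentiableOn.cpow_const (by fun_prop) fun z hz => (hz s hs).1)
      (DifferentiableOn.cpow_const (by fun_prop) fun z hz => (hz _ (one_sub_mem_Icc hs)).2.1)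

lemma differentiableOn_legendreKernel (a : ℝ) (α β : ℂ) :
    DifferentiableOn ℂ (legendreKernel a α β) (kernelDomain α β) := by
  refine (differentiableOn_legendreFun a).comp (by fun_prop) fun z hz => ?_
  simpa using (hz 1 ⟨zero_le_one, le_rfl⟩).2.2

/-- A beta integral of `f (s z)` depends holomorphically on `z`. -/
lemma differentiableOn_integral_betaWeight_comp_mul {u v α β : ℂ} (hu : 0 < u.re) (hv : 0 < v.re)
    {f : ℂ → ℂ} (hf : DifferentiableOn ℂ f (kernelDomain α β)) :
    DifferentiableOn ℂ (fun z => ∫ s in (0 : ℝ)..1, betaWeight u v s * f (s * z))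
      (kernelDomain α β) := by
  refine differentiableOn_integral_weight (g := fun s z => f (s * z))
    (intervalIntegrable_betaWeight hu hv) (isOpen_kernelDomain α β) ?_ fun s hs => ?_
  · exact hf.continuousOn.comp (by fun_prop) fun p hp => ofReal_mul_mem_kernelDomain hp.2 hp.1
  · exact hf.comp (by fun_prop) fun z hz => ofReal_mul_mem_kernelDomain hz hs

lemma hasSum_integral_betaWeight {u v : ℂ} (hu : 0 < u.re) (hv : 0 < v.re) {c : ℕ × ℕ → ℂ}
    (hc : Summable c) {f : ℝ → ℂ}
    (hf : ∀ s ∈ Icc (0 : ℝ) 1, HasSum (fun i => c i * (s : ℂ) ^ (i.1 + i.2)) (f s)) :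
    HasSum (fun i => c i * betaIntegral (u + (i.1 + i.2 : ℕ)) v)
      (∫ s in (0 : ℝ)..1, betaWeight u v s * f s) := by
  have h := hasSum_integral_weight (intervalIntegrable_betaWeight hu hv)
    (F := fun (i : ℕ × ℕ) (s : ℝ) => c i * (s : ℂ) ^ (i.1 + i.2)) (b := fun i => ‖c i‖)
    (fun i => by fun_prop) hc.norm (fun i s hs => ?_) hf
  · convert! h using 2 with i
    have h1 := integral_betaWeight_mul u v (i.1 + i.2) 0
    simp only [pow_zero, mul_one, Nat.cast_zero, add_zero] at h1
    rw [← h1, ← intervalIntegral.integral_const_mul]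
    exact intervalIntegral.integral_congr fun s _ => by ring
  · rw [norm_mul, norm_pow, norm_real, Real.norm_of_nonneg hs.1]
    exact mul_le_of_le_one_right (norm_nonneg _) (pow_le_one₀ hs.1 hs.2)

lemma polyGrowth_risingCoeff (a : ℝ) : PolyGrowth fun k => (risingCoeff a k : ℂ) := by
  obtain ⟨N, hN⟩ := exists_nat_ge |a|
  refine ⟨1, N, fun k => ?_⟩
  rw [norm_real, Real.norm_eq_abs, one_mul]
  exact abs_ascPochhammer_div_factorial_le hN k

lemma hasSum_risingCoeff_mul_risingCoeff (b : ℝ) {x y : ℂ} (hx : ‖x‖ < 1) (hy : ‖y‖ < 1) :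
    HasSum (fun i : ℕ × ℕ => ((risingCoeff b i.1 : ℂ) * x ^ i.1) *
      ((risingCoeff b i.2 : ℂ) * y ^ i.2)) ((1 - x) ^ (-b : ℂ) * (1 - y) ^ (-b : ℂ)) := by
  have n1 := (polyGrowth_risingCoeff b).summable_norm hx
  have n2 := (polyGrowth_risingCoeff b).summable_norm hy
  have h := (summable_mul_of_summable_norm n1 n2).hasSum
  rw [← n1.of_norm.tsum_mul_tsum n2.of_norm h.summable, (hasSum_risingCoeff b hx).tsum_eq,
    (hasSum_risingCoeff b hy).tsum_eq] at h
  exact h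

lemma hasSum_convKernel {a : ℝ} (ha : 0 < a) {α β z : ℂ} (hα : ‖α * z‖ < 1 / 3)
    (hβ : ‖β * z‖ < 1 / 3) :
    HasSum (fun i : ℕ × ℕ => (risingCoeff (1 - a) i.1 : ℂ) * risingCoeff (1 - a) i.2 *
      betaIntegral (a + i.1) (a + i.2) * ((-(α * z)) ^ i.1 * (-(β * z)) ^ i.2))
      (convKernel a α β z) := by
  have hr := polyGrowth_risingCoeff (1 - a)
  have hx1 : ‖-(α * z)‖ < 1 := by rw [norm_neg]; linarith
  have hy1 : ‖-(β * z)‖ < 1 := by rw [norm_neg]; linarith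
  have ha' : 0 < (a : ℂ).re := by simpa using ha
  have h := hasSum_integral_weight (w := betaWeight a a) (intervalIntegrable_betaWeight ha' ha')
    (F := fun (i : ℕ × ℕ) (s : ℝ) => ((risingCoeff (1 - a) i.1 : ℂ) * (-(α * (s * z))) ^ i.1) *
      ((risingCoeff (1 - a) i.2 : ℂ) * (-(β * ((1 - s : ℝ) * z))) ^ i.2))
    (b := fun i => ‖(risingCoeff (1 - a) i.1 : ℂ) * (-(α * z)) ^ i.1‖ *
      ‖(risingCoeff (1 - a) i.2 : ℂ) * (-(β * z)) ^ i.2‖)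
    (f := fun s => (1 + α * (s * z)) ^ (a - 1 : ℂ) * (1 + β * ((1 - s : ℝ) * z)) ^ (a - 1 : ℂ))
    (fun i => by fun_prop)
    ((hr.summable_norm hx1).mul_of_nonneg (hr.summable_norm hy1) (fun _ => norm_nonneg _)
      fun _ => norm_nonneg _) ?_ ?_
  · convert! h using 2 with i
    have h1 := integral_betaWeight_mul (a : ℂ) a i.1 i.2
    rw [← h1, mul_right_comm, ← intervalIntegral.integral_const_mul]
    refine intervalIntegral.integral_congr fun s _ => ?_
    simp only [show α * (s * z) = s * (α * z) by ring,
      show β * ((1 - s : ℝ) * z) = (1 - s : ℂ) * (β * z) by push_cast; ring, neg_mul_eq_mul_neg,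
      mul_pow]
    ring
  · intro i s hs
    have hle : ∀ (r : ℝ) (c : ℂ), r ∈ Icc (0 : ℝ) 1 → ‖-(c * (r * z))‖ ≤ ‖-(c * z)‖ := by
      intro r c hr
      rw [show c * (r * z) = r * (c * z) by ring, norm_neg, norm_neg, norm_mul, norm_real,
        Real.norm_of_nonneg hr.1]
      exact mul_le_of_le_one_left (norm_nonneg _) hr.2
    simp only [norm_mul, norm_pow]
    gcongr ‖_‖ * ?_ ^ _ * (‖_‖ * ?_ ^ _)
    · simpa only [norm_mul, norm_neg] using hle s α hs
    · simpa only [norm_mul, norm_neg] using hle (1 - s) β (one_sub_mem_Icc hs)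
  · intro s hs
    have hle : ∀ (r : ℝ) (c : ℂ), r ∈ Icc (0 : ℝ) 1 → ‖-(c * z)‖ < 1 → ‖-(c * (r * z))‖ < 1 := by
      intro r c hr h
      rw [show c * (r * z) = r * (c * z) by ring, norm_neg, norm_mul, norm_real,
        Real.norm_of_nonneg hr.1]
      rw [norm_neg] at h
      exact lt_of_le_of_lt (mul_le_of_le_one_left (norm_nonneg _) hr.2) h
    have h1 := hle s α hs hx1
    have h2 := hle (1 - s) β (one_sub_mem_Icc hs) hy1
    have h3 := hasSum_risingCoeff_mul_risingCoeff (1 - a) h1 h2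
    rw [show (-((1 - a : ℝ) : ℂ)) = a - 1 by push_cast; ring, sub_neg_eq_add, sub_neg_eq_add] at h3
    exact h3

lemma hasSum_legendreKernel (a : ℝ) {α β z : ℂ} (hα : ‖α * z‖ < 1 / 3) (hβ : ‖β * z‖ < 1 / 3) :
    HasSum (fun i : ℕ × ℕ => (appellCoeff a i.1 i.2 : ℂ) * ((-(α * z)) ^ i.1 * (-(β * z)) ^ i.2))
      (legendreKernel a α β z) := by
  have h := hasSum_appellCoeff a (x := -(α * z)) (y := -(β * z)) (by rwa [norm_neg])
    (by rwa [norm_neg])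
  simp only [mul_assoc] at h ⊢
  convert! h using 1
  have e : -(α * z) + (-(β * z) - -(α * z) * -(β * z)) = 1 - (1 + α * z) * (1 + β * z) := by ring
  rw [legendreKernel, legendreFun_of_mem_ball]
  · congr 1; ring
  · rw [mem_ball_iff_norm, show (1 + α * z) * (1 + β * z) - 1 = α * z + β * z + α * z * (β * z) by ring]
    refine (norm_add_le _ _).trans_lt ?_
    have := norm_add_le (α * z) (β * z)
    rw [norm_mul (α * z)]
    nlinarith [norm_nonneg (α * z), norm_nonneg (β * z)]

/-- The fractional integral of the hypergeometric kernel is the primitive of the convolution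
kernel. -/
lemma integral_convKernel_eq {a : ℝ} (ha : 0 < a) {α β z : ℂ} (hz : z ∈ kernelDomain α β) :
    ∫ s in (0 : ℝ)..1, betaWeight (2 * a) 1 s * convKernel a α β (s * z) =
      Gamma a ^ 2 / Gamma (2 * a) *
        ∫ s in (0 : ℝ)..1, betaWeight 1 (2 * a) s * legendreKernel a α β (s * z) := by
  have h2a : 0 < (2 * (a : ℂ)).re := by
    rw [show (2 : ℂ) * a = ((2 * a : ℝ) : ℂ) by push_cast; rfl, ofReal_re]; positivity
  have h1 : 0 < (1 : ℂ).re := one_pos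
  have hopen := isOpen_kernelDomain α β
  -- Both sides are holomorphic on a connected domain, so it suffices to compare them near 0, where
  -- they are double series in -αz and -βz.
  refine AnalyticOnNhd.eqOn_of_preconnected_of_eventuallyEq (z₀ := 0)
    ((differentiableOn_integral_betaWeight_comp_mul h2a h1
      (differentiableOn_convKernel ha α β)).analyticOnNhd hopen)
    (((differentiableOn_integral_betaWeight_comp_mul h1 h2a
      (differentiableOn_legendreKernel a α β)).const_mul _).analyticOnNhd hopen)
    (isPreconnected_kernelDomain α β) (zero_mem_kernelDomain α β) ?_ hz
  have ev : ∀ c : ℂ, ∀ᶠ z : ℂ in 𝓝 0, ‖c * z‖ < 1 / 3 := fun c => by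
    have : Continuous fun z : ℂ => ‖c * z‖ := by fun_prop
    exact this.continuousAt.eventually_lt continuousAt_const (by simp)
  filter_upwards [ev α, ev β] with z hα hβ
  have hle : ∀ (r : ℝ) (c : ℂ), r ∈ Icc (0 : ℝ) 1 → ‖c * z‖ < 1 / 3 → ‖c * (r * z)‖ < 1 / 3 := by
    intro r c hr h
    rw [show c * (r * z) = r * (c * z) by ring, norm_mul, norm_real, Real.norm_of_nonneg hr.1]
    exact lt_of_le_of_lt (mul_le_of_le_one_left (norm_nonneg _) hr.2) h
  have hmul : ∀ (s : ℝ) (i : ℕ × ℕ), (-(α * (s * z))) ^ i.1 * (-(β * (s * z))) ^ i.2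
      = ((-(α * z)) ^ i.1 * (-(β * z)) ^ i.2) * (s : ℂ) ^ (i.1 + i.2) := fun s i => by
    simp only [show ∀ c : ℂ, -(c * (s * z)) = s * -(c * z) from fun c => by ring, mul_pow, pow_add]
    ring
  have hN := hasSum_integral_betaWeight h2a h1 (hasSum_convKernel ha hα hβ).summable
    (f := fun s => convKernel a α β (s * z)) fun s hs => by
      have := hasSum_convKernel ha (hle s α hs hα) (hle s β hs hβ)
      simp only [hmul] at this
      simpa only [mul_assoc] using this
  have hR := hasSum_integral_betaWeight h1 h2a (hasSum_legendreKernel a hα hβ).summable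
    (f := fun s => legendreKernel a α β (s * z)) fun s hs => by
      have := hasSum_legendreKernel a (hle s α hs hα) (hle s β hs hβ)
      simp only [hmul] at this
      simpa only [mul_assoc] using this
  rw [← hN.tsum_eq, ← hR.tsum_eq, ← tsum_mul_left]
  refine tsum_congr fun i => ?_
  have hk : 0 < (2 * (a : ℂ) + (i.1 + i.2 : ℕ)).re := by
    rw [add_re, natCast_re]; positivity
  rw [betaIntegral_eval_one_right hk]
  linear_combination ((-(α * z)) ^ i.1 * (-(β * z)) ^ i.2) *
    betaIntegral_mul_eq_appellCoeff ha i.1 i.2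

/-! ### Laplace transforms and the product formula -/

/-- The Laplace transform at `t` of `τ ^ (s - 1) * φ τ`. -/
noncomputable def laplaceMellin (t : ℝ) (s : ℂ) (φ : ℝ → ℂ) : ℂ :=
  ∫ τ in Ioi (0 : ℝ), cexp (-(t * τ)) * ((τ : ℂ) ^ (s - 1) * φ τ)

/-- Continuity on `[0, ∞)` together with polynomial growth at infinity. -/
def TameOn (φ : ℝ → ℂ) : Prop :=
  ContinuousOn φ (Ici 0) ∧ ∃ k : ℝ, φ =O[atTop] fun τ : ℝ => τ ^ k

/-- Half of the exponential decay absorbs the polynomial growth at infinity; near 0 the function φ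
is bounded, so Re s > 0 suffices. -/
lemma TameOn.integrableOn {φ : ℝ → ℂ} (hφ : TameOn φ) {t : ℝ} (ht : 0 < t) {s : ℂ}
    (hs : 0 < s.re) :
    IntegrableOn (fun τ : ℝ => cexp (-(t * τ)) * ((τ : ℂ) ^ (s - 1) * φ τ)) (Ioi 0) := by
  obtain ⟨hc, k, hk⟩ := hφ
  have hcont : ContinuousOn (fun τ : ℝ => cexp (-(t * τ)) * φ τ) (Ici 0) :=
    (by fun_prop : Continuous fun τ : ℝ => cexp (-(t * τ))).continuousOn.mul hc
  have hexp : ∀ τ : ℝ, ‖cexp (-(t * τ))‖ = Real.exp (-(t * τ)) := fun τ => by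
    rw [← ofReal_mul, ← ofReal_neg, norm_exp_ofReal]
  have hM : MellinConvergent (fun τ : ℝ => cexp (-(t * τ)) * φ τ) s := by
    refine mellinConvergent_of_isBigO_rpow_exp (a := t / 2) (b := 0) (by positivity)
      ((hcont.mono Ioi_subset_Ici_self).locallyIntegrableOn measurableSet_Ioi) ?_ ?_ hs
    · have h1 : (fun τ : ℝ => cexp (-(t * τ))) =O[atTop] fun τ : ℝ => Real.exp (-(t * τ)) :=
        IsBigO.of_bound 1 (Eventually.of_forall fun τ => by
          rw [hexp, one_mul]; exact le_abs_self _)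
      have h2 := hk.trans (isLittleO_rpow_exp_pos_mul_atTop k (half_pos ht)).isBigO
      refine (h1.mul h2).congr_right fun τ => ?_
      rw [← Real.exp_add]; congr 1; ring
    · have h3 : ContinuousWithinAt (fun τ : ℝ => cexp (-(t * τ)) * φ τ) (Ioi 0) 0 :=
        (hcont 0 self_mem_Ici).mono Ioi_subset_Ici_self
      simpa using h3.tendsto.isBigO_one ℝ
  refine hM.congr_fun (fun τ _ => ?_) measurableSet_Ioi
  simp only [smul_eq_mul]
  ring

lemma tameOn_one : TameOn fun _ => 1 :=
  ⟨continuousOn_const, 0, IsBigO.of_bound 1 (Eventually.of_forall fun τ => by simp)⟩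

lemma laplaceMellin_one {t : ℝ} (ht : 0 < t) {s : ℂ} (hs : 0 < s.re) :
    laplaceMellin t s (fun _ => 1) = (1 / t : ℂ) ^ s * Gamma s := by
  rw [← Complex.integral_cpow_mul_exp_neg_mul_Ioi hs ht, laplaceMellin]
  refine integral_congr_ae (Eventually.of_forall fun τ => ?_)
  simp only
  ring

lemma laplaceMellin_one_eq_rpow_mul {t : ℝ} (ht : 0 < t) (s : ℂ) (φ : ℝ → ℂ) :
    laplaceMellin 1 s φ = (t : ℂ) ^ s * laplaceMellin t s fun τ => φ (t * τ) := by
  have h := integral_comp_mul_left_Ioi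
    (fun u : ℝ => cexp (-(((1 : ℝ) : ℂ) * u)) * ((u : ℂ) ^ (s - 1) * φ u)) 0 ht
  rw [mul_zero] at h
  have ht0 : (t : ℂ) ≠ 0 := by exact_mod_cast ht.ne'
  rw [laplaceMellin, ← smul_inv_smul₀ ht.ne' (∫ τ in Ioi (0 : ℝ), _), ← h, laplaceMellin, real_smul,
    ← integral_const_mul, ← integral_const_mul]
  refine setIntegral_congr_fun measurableSet_Ioi fun τ hτ => ?_
  have h1 : (t : ℂ) ^ s = t * t ^ (s - 1) := by
    rw [cpow_sub _ _ ht0, cpow_one]; field_simp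
  rw [ofReal_mul, mul_cpow_ofReal_nonneg ht.le (le_of_lt hτ), h1, ofReal_one, one_mul]
  ring

lemma integral_mul_comp_sub_eq (u v : ℂ) (φ ψ : ℝ → ℂ) (t : ℝ) {x : ℝ} (hx : 0 < x) :
    ∫ s in (0 : ℝ)..x, (cexp (-(t * s)) * ((s : ℂ) ^ (u - 1) * φ s)) *
        (cexp (-(t * (x - s : ℝ))) * (((x - s : ℝ) : ℂ) ^ (v - 1) * ψ (x - s))) =
      cexp (-(t * x)) * ((x : ℂ) ^ (u + v - 1) *
        ∫ r in (0 : ℝ)..1, betaWeight u v r * (φ (r * x) * ψ ((1 - r) * x))) := by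
  have h := intervalIntegral.integral_comp_mul_left (a := 0) (b := 1)
    (fun s : ℝ => (cexp (-(t * s)) * ((s : ℂ) ^ (u - 1) * φ s)) *
        (cexp (-(t * (x - s : ℝ))) * (((x - s : ℝ) : ℂ) ^ (v - 1) * ψ (x - s)))) hx.ne'
  rw [mul_zero, mul_one] at h
  have hx0 : (x : ℂ) ≠ 0 := by exact_mod_cast hx.ne'
  rw [← smul_inv_smul₀ hx.ne' (∫ s in (0 : ℝ)..x, _), ← h, real_smul,
    ← intervalIntegral.integral_const_mul, ← intervalIntegral.integral_const_mul,
    ← intervalIntegral.integral_const_mul]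
  refine intervalIntegral.integral_congr_Ioo_of_le zero_le_one fun r hr => ?_
  have e1 : x - x * r = x * (1 - r) := by ring
  have e2 : cexp (-(t * x)) = cexp (-(t * (x * r : ℝ))) * cexp (-(t * (x * (1 - r) : ℝ))) := by
    rw [← Complex.exp_add]; congr 1; push_cast; ring
  have e3 : (x : ℂ) ^ (u + v - 1) = x * (x ^ (u - 1) * x ^ (v - 1)) := by
    rw [show u + v - 1 = 1 + ((u - 1) + (v - 1)) by ring, cpow_add _ _ hx0, cpow_add _ _ hx0,
      cpow_one]
  simp only [e1]
  rw [e2, e3, betaWeight, mul_comm r x, mul_comm (1 - r) x]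
  rw [ofReal_mul x r, ofReal_mul x (1 - r), mul_cpow_ofReal_nonneg hx.le hr.1.le,
    mul_cpow_ofReal_nonneg hx.le (sub_pos.2 hr.2).le]
  push_cast
  ring

/-- The convolution theorem, with the convolution over [0, x] rescaled to [0, 1] so that the power
of x splits off. -/
lemma laplaceMellin_mul {t : ℝ} {u v : ℂ} {φ ψ : ℝ → ℂ}
    (hφ : IntegrableOn (fun τ : ℝ => cexp (-(t * τ)) * ((τ : ℂ) ^ (u - 1) * φ τ)) (Ioi 0))
    (hψ : IntegrableOn (fun τ : ℝ => cexp (-(t * τ)) * ((τ : ℂ) ^ (v - 1) * ψ τ)) (Ioi 0)) :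
    laplaceMellin t u φ * laplaceMellin t v ψ = laplaceMellin t (u + v) fun x =>
      ∫ r in (0 : ℝ)..1, betaWeight u v r * (φ (r * x) * ψ ((1 - r) * x)) := by
  have h := integral_posConvolution hφ hψ (ContinuousLinearMap.mul ℝ ℂ)
  simp only [ContinuousLinearMap.mul_apply'] at h
  rw [laplaceMellin, laplaceMellin, ← h, laplaceMellin]
  exact setIntegral_congr_fun measurableSet_Ioi fun x hx => integral_mul_comp_sub_eq u v φ ψ t hx

lemma integrableOn_laplaceMellin_mul {t : ℝ} {u v : ℂ} {φ ψ : ℝ → ℂ}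
    (hφ : IntegrableOn (fun τ : ℝ => cexp (-(t * τ)) * ((τ : ℂ) ^ (u - 1) * φ τ)) (Ioi 0))
    (hψ : IntegrableOn (fun τ : ℝ => cexp (-(t * τ)) * ((τ : ℂ) ^ (v - 1) * ψ τ)) (Ioi 0)) :
    IntegrableOn (fun x : ℝ => cexp (-(t * x)) * ((x : ℂ) ^ (u + v - 1) *
      ∫ r in (0 : ℝ)..1, betaWeight u v r * (φ (r * x) * ψ ((1 - r) * x)))) (Ioi 0) := by
  have h := (integrable_posConvolution hφ hψ (ContinuousLinearMap.mul ℝ ℂ)).integrableOn (s := Ioi 0)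
  refine h.congr_fun (fun x hx => ?_) measurableSet_Ioi
  rw [posConvolution, indicator_of_mem hx]
  exact integral_mul_comp_sub_eq u v φ ψ t hx

lemma isBigO_norm_one_add_mul_rpow {α : ℂ} (hα : α ≠ 0) (k : ℝ) :
    (fun τ : ℝ => ‖1 + α * τ‖ ^ k) =O[atTop] fun τ : ℝ => τ ^ k := by
  have h1 : Tendsto (fun τ : ℝ => ‖(τ : ℂ)⁻¹ + α‖) atTop (𝓝 ‖α‖) := by
    have h2 : Tendsto (fun τ : ℝ => ((τ⁻¹ : ℝ) : ℂ)) atTop (𝓝 0) := by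
      have := (continuous_ofReal.tendsto 0).comp tendsto_inv_atTop_zero
      simpa [Function.comp_def] using this
    have h3 := (h2.add_const α).norm
    rw [zero_add] at h3
    exact h3.congr fun τ => by rw [ofReal_inv]
  have h4 := h1.rpow_const (p := k) (Or.inl (norm_ne_zero_iff.2 hα))
  refine isBigO_of_div_tendsto_nhds ?_ _ (h4.congr' ?_)
  · filter_upwards [eventually_gt_atTop 0] with τ hτ h0
    exact absurd h0 (Real.rpow_pos_of_pos hτ k).ne'
  · filter_upwards [eventually_gt_atTop 0] with τ hτ
    have hτ' : (τ : ℂ) ≠ 0 := by exact_mod_cast hτ.ne'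
    rw [Pi.div_apply, ← Real.div_rpow (norm_nonneg _) hτ.le]
    congr 1
    rw [show (τ : ℂ)⁻¹ + α = (1 + α * τ) / τ by field_simp, norm_div, norm_real,
      Real.norm_of_nonneg hτ.le]

lemma tameOn_one_add_mul_cpow {α : ℂ} (hα : α ∈ slitPlane) (k : ℝ) :
    TameOn fun τ => (1 + α * τ) ^ (k : ℂ) := by
  refine ⟨ContinuousOn.cpow (by fun_prop) continuousOn_const fun τ hτ =>
    one_add_mul_ofReal_mem_slitPlane hα hτ, k, ?_⟩
  refine IsBigO.trans (IsBigO.of_bound 1 (Eventually.of_forall fun τ => ?_))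
    (isBigO_norm_one_add_mul_rpow (slitPlane_ne_zero hα) k)
  rw [norm_cpow_real, one_mul]
  exact le_abs_self _

lemma conj_mem_slitPlane {α : ℂ} (hα : α ∈ slitPlane) : (starRingEnd ℂ) α ∈ slitPlane := by
  rcases hα with h | h
  · exact Or.inl (by simpa using h)
  · exact Or.inr (by simpa using h)

lemma legendreKernel_ofReal (a : ℝ) (α : ℂ) (τ : ℝ) :
    legendreKernel a α ((starRingEnd ℂ) α) τ = legendreFun a (normSq (1 + α * τ) : ℝ) := by
  rw [legendreKernel, one_add_mul_one_add_conj]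

lemma tendsto_normSq_one_add_mul {α : ℂ} (hα : α ≠ 0) :
    Tendsto (fun τ : ℝ => normSq (1 + α * τ)) atTop atTop := by
  have h1 : Tendsto (fun τ : ℝ => ‖α‖ * τ - 1) atTop atTop :=
    tendsto_atTop_add_const_right _ _ (tendsto_id.const_mul_atTop (norm_pos_iff.2 hα))
  refine tendsto_atTop_mono' _ ?_ ((tendsto_pow_atTop two_ne_zero).comp h1)
  filter_upwards [h1.eventually_ge_atTop 0, eventually_ge_atTop 0] with τ h2 h3
  rw [Function.comp_apply, normSq_eq_norm_sq]
  refine pow_le_pow_left₀ h2 ?_ 2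
  have := norm_sub_norm_le (α * τ) (-1)
  rw [sub_neg_eq_add, norm_neg, norm_one, norm_mul, norm_real, Real.norm_of_nonneg h3,
    add_comm (α * (τ : ℂ))] at this
  exact this

lemma tameOn_legendreKernel (a : ℝ) {α : ℂ} (hα : α ∈ slitPlane) :
    TameOn fun τ => legendreKernel a α ((starRingEnd ℂ) α) τ := by
  refine ⟨(differentiableOn_legendreKernel a _ _).continuousOn.comp
    continuous_ofReal.continuousOn fun τ hτ => ofReal_mem_kernelDomain hα hτ, ?_⟩
  obtain ⟨C, s, hC, h⟩ := exists_legendreFun_ofReal_le a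
  refine ⟨2 * s, IsBigO.trans (IsBigO.of_bound C ?_)
    (isBigO_norm_one_add_mul_rpow (slitPlane_ne_zero hα) (2 * s))⟩
  filter_upwards [(tendsto_normSq_one_add_mul (slitPlane_ne_zero hα)).eventually_ge_atTop 1]
    with τ hτ
  rw [legendreKernel_ofReal, ← legendreFun_ofReal_re a (by linarith), norm_real, Real.norm_eq_abs]
  refine (h _ hτ).trans (mul_le_mul_of_nonneg_left ?_ hC)
  rw [normSq_eq_norm_sq, ← Real.rpow_natCast, ← Real.rpow_mul (norm_nonneg _)]
  exact le_abs_self _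

/-- Convolving the convolution density with 1, and the hypergeometric kernel with τ^(2a-1), gives
proportional functions by `integral_convKernel_eq`. On transforms these convolutions are
multiplications by 1/t and Γ(2a) t^(-2a), which can be divided out. -/
lemma laplaceMellin_product {a : ℝ} (ha : 0 < a) {α : ℂ} (hα : α ∈ slitPlane) {t : ℝ} (ht : 0 < t) :
    laplaceMellin t a (fun τ => (1 + α * τ) ^ (a - 1 : ℂ)) *
      laplaceMellin t a (fun τ => (1 + (starRingEnd ℂ) α * τ) ^ (a - 1 : ℂ)) =
    Gamma a ^ 2 * (t : ℂ) ^ (1 - 2 * a : ℂ) *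
      laplaceMellin t 1 (fun τ => legendreKernel a α ((starRingEnd ℂ) α) τ) := by
  set β := (starRingEnd ℂ) α with hβ
  have ha' : 0 < (a : ℂ).re := by simpa using ha
  have h2a : 0 < (2 * (a : ℂ)).re := by
    rw [show (2 : ℂ) * a = ((2 * a : ℝ) : ℂ) by push_cast; rfl, ofReal_re]; positivity
  have h1 : 0 < (1 : ℂ).re := one_pos
  have ht0 : (t : ℂ) ≠ 0 := by exact_mod_cast ht.ne'
  have e : ((a - 1 : ℝ) : ℂ) = a - 1 := by push_cast; rfl
  have iα := (tameOn_one_add_mul_cpow hα (a - 1)).integrableOn ht ha'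
  have iβ := (tameOn_one_add_mul_cpow (conj_mem_slitPlane hα) (a - 1)).integrableOn ht ha'
  rw [e] at iα iβ
  have hconv : ∀ x : ℝ, (∫ r in (0 : ℝ)..1, betaWeight a a r *
      ((1 + α * (r * x : ℝ)) ^ (a - 1 : ℂ) * (1 + β * ((1 - r) * x : ℝ)) ^ (a - 1 : ℂ))) =
      convKernel a α β x := fun x => by
    rw [convKernel]; push_cast; rfl
  have p1 := laplaceMellin_mul iα iβ
  have i1 := integrableOn_laplaceMellin_mul iα iβ
  rw [← hβ] at p1 i1
  simp only [hconv, ← two_mul] at p1 i1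
  have p2 := laplaceMellin_mul i1 (tameOn_one.integrableOn ht h1)
  have p3 := laplaceMellin_mul ((tameOn_legendreKernel a hα).integrableOn ht h1)
    (tameOn_one.integrableOn ht h2a)
  have p4 : laplaceMellin t (2 * a + 1) (fun x => ∫ r in (0 : ℝ)..1,
        betaWeight (2 * a) 1 r * (convKernel a α β (r * x : ℝ) * 1)) =
      Gamma a ^ 2 / Gamma (2 * a) * laplaceMellin t (1 + 2 * a) (fun x => ∫ r in (0 : ℝ)..1,
        betaWeight 1 (2 * a) r * (legendreKernel a α β (r * x : ℝ) * 1)) := by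
    rw [laplaceMellin, laplaceMellin, ← integral_const_mul]
    refine setIntegral_congr_fun measurableSet_Ioi fun x hx => ?_
    have := integral_convKernel_eq ha (ofReal_mem_kernelDomain hα (le_of_lt hx))
    simp only [ofReal_mul, mul_one]
    rw [this, add_comm (1 : ℂ)]
    ring
  rw [← p2, ← p3, ← p1, laplaceMellin_one ht h1, laplaceMellin_one ht h2a, cpow_one,
    Gamma_one, one_div, inv_cpow _ _ (by rw [arg_ofReal_of_nonneg ht.le]; exact Real.pi_pos.ne)] at p4
  have hG : Gamma (2 * (a : ℂ)) ≠ 0 := Gamma_ne_zero_of_re_pos h2a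
  rw [cpow_sub _ _ ht0, cpow_one]
  have hp : (t : ℂ) ^ (2 * a : ℂ) ≠ 0 := by rw [Ne, cpow_eq_zero_iff]; tauto
  generalize (t : ℂ) ^ (2 * a : ℂ) = q at p4 hp ⊢
  generalize Gamma (2 * (a : ℂ)) = g at p4 hG
  field_simp at p4 ⊢
  exact p4

/-! ### Strict complete monotonicity of Laplace transforms -/

/-- The Laplace transform of a nonnegative continuous function that is positive at the origin is
strictly completely monotone. -/
lemma strictlyCompletelyMonotone_of_laplace {f h : ℝ → ℝ} (hc : ContinuousOn h (Ici 0))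
    (h0 : ∀ τ, 0 < τ → 0 ≤ h τ) (hpos : 0 < h 0)
    (hint : ∀ t : ℝ, 0 < t → IntegrableOn (fun τ => Real.exp (-(t * τ)) * h τ) (Ioi 0))
    (hf : ∀ t : ℝ, 0 < t → f t = ∫ τ in Ioi (0 : ℝ), Real.exp (-(t * τ)) * h τ) :
    StrictlyCompletelyMonotone f := by
  let d : ℝ → NNReal := fun τ => (h τ).toNNReal
  have hd : AEMeasurable d (volume.restrict (Ioi 0)) :=
    ((hc.mono Ioi_subset_Ici_self).aemeasurable measurableSet_Ioi).real_toNNReal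
  let μ : Measure ℝ := (volume.restrict (Ioi 0)).withDensity fun τ => (d τ : ENNReal)
  have hsmul : ∀ g : ℝ → ℝ, (fun τ => d τ • g τ) =ᵐ[volume.restrict (Ioi 0)] fun τ => g τ * h τ :=
    fun g => by
      filter_upwards [ae_restrict_mem measurableSet_Ioi] with τ hτ
      rw [NNReal.smul_def, smul_eq_mul, Real.coe_toNNReal _ (h0 τ hτ), mul_comm]
  have hI : ∀ g : ℝ → ℝ, ∫ τ, g τ ∂μ = ∫ τ in Ioi (0 : ℝ), g τ * h τ := fun g => by
    rw [integral_withDensity_eq_integral_smul₀ hd, integral_congr_ae (hsmul g)]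
  have hint' : ∀ g : ℝ → ℝ, Integrable g μ ↔ IntegrableOn (fun τ => g τ * h τ) (Ioi 0) := fun g => by
    rw [integrable_withDensity_iff_integrable_smul₀ hd, integrable_congr (hsmul g)]; rfl
  -- For the measure h dτ and X = -τ, the Laplace transform is a moment generating function; its
  -- smoothness and the moment formula for its derivatives then apply.
  let X : ℝ → ℝ := fun τ => -τ
  have hX : ∀ t τ : ℝ, t * X τ = -(t * τ) := fun t τ => by simp [X]
  have hmem : ∀ t : ℝ, 0 < t → t ∈ interior (ProbabilityTheory.integrableExpSet X μ) := by
    intro t ht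
    refine interior_maximal (fun s hs => ?_) isOpen_Ioi (show t ∈ Ioi 0 from ht)
    change Integrable (fun τ => Real.exp (s * X τ)) μ
    simp only [hX]
    exact (hint' _).2 (hint s hs)
  have hmgf : ∀ t : ℝ, 0 < t → f t = ProbabilityTheory.mgf X μ t := fun t ht => by
    rw [hf t ht, ProbabilityTheory.mgf, hI]
    simp only [hX]
  refine ⟨?_, fun n t ht => ?_⟩
  · refine ContDiffOn.congr (f := ProbabilityTheory.mgf X μ) ?_ hmgf
    exact (ProbabilityTheory.analyticOn_mgf.mono hmem).contDiffOn (uniqueDiffOn_Ioi 0)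
  · have hev : f =ᶠ[𝓝 t] ProbabilityTheory.mgf X μ := by
      filter_upwards [Ioi_mem_nhds ht] with s hs using hmgf s hs
    rw [hev.iteratedDeriv_eq n, ProbabilityTheory.iteratedDeriv_mgf (hmem t ht),
      ← integral_const_mul, hI]
    have hi := (hint' _).1 ((ProbabilityTheory.integrable_pow_mul_exp_of_mem_interior_integrableExpSet
      (hmem t ht) n).const_mul ((-1) ^ n))
    have he : ∀ τ : ℝ, (-1) ^ n * (X τ ^ n * Real.exp (t * X τ)) = τ ^ n * Real.exp (-(t * τ)) :=
      fun τ => by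
        rw [hX, ← mul_assoc, ← mul_pow]
        simp [X]
    simp only [he] at hi ⊢
    refine (setIntegral_pos_iff_support_of_nonneg_ae ?_ hi).2 ?_
    · filter_upwards [ae_restrict_mem measurableSet_Ioi] with τ hτ
      have h1 : (0 : ℝ) < τ := hτ
      have h2 := h0 τ hτ
      rw [Pi.zero_apply]; positivity
    -- Strictness: h stays positive on some [0, δ), so the integrand has support of positive
    -- measure.
    · have h1 : ∀ᶠ τ in 𝓝[≥] (0 : ℝ), 0 < h τ :=
        (hc 0 self_mem_Ici).eventually (lt_mem_nhds hpos)
      obtain ⟨δ, hδ, hδ'⟩ := (mem_nhdsGE_iff_exists_Ico_subset).1 h1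
      have hδ0 : (0 : ℝ) < δ := hδ
      refine lt_of_lt_of_le ?_ (measure_mono (s := Ioo 0 δ) fun τ hτ => ⟨?_, hτ.1⟩)
      · simpa using hδ0
      · have h2 : 0 < h τ := hδ' ⟨hτ.1.le, hτ.2⟩
        have h3 : 0 < τ := hτ.1
        exact (by positivity : 0 < τ ^ n * Real.exp (-(t * τ)) * h τ).ne'

/-! ### The squared modulus of the Bessel function as a Laplace transform -/

lemma inv_two_mul_mem_slitPlane {x : ℂ} (hx : x ∈ slitPlane) : (2 * x)⁻¹ ∈ slitPlane := by
  have h0 : 0 < normSq (2 * x) := normSq_pos.2 (mul_ne_zero two_ne_zero (slitPlane_ne_zero hx))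
  rcases hx with h | h
  · refine Or.inl ?_
    rw [inv_re]
    exact div_pos (by simpa using h) h0
  · refine Or.inr ?_
    rw [inv_im]
    exact div_ne_zero (by simpa using h) h0.ne'

lemma conj_laplaceMellin (t a : ℝ) {α : ℂ} (hα : α ∈ slitPlane) :
    (starRingEnd ℂ) (laplaceMellin t a fun τ => (1 + α * τ) ^ (a - 1 : ℂ)) =
      laplaceMellin t a fun τ => (1 + (starRingEnd ℂ) α * τ) ^ (a - 1 : ℂ) := by
  rw [laplaceMellin, ← integral_conj, laplaceMellin]
  refine setIntegral_congr_fun measurableSet_Ioi fun τ hτ => ?_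
  have hτ0 : 0 ≤ τ := le_of_lt hτ
  have e : (starRingEnd ℂ) (a - 1 : ℂ) = a - 1 := by simp
  have h1 := slitPlane_arg_ne_pi (one_add_mul_ofReal_mem_slitPlane hα hτ0)
  have h2 : arg (τ : ℂ) ≠ Real.pi := by rw [arg_ofReal_of_nonneg hτ0]; exact Real.pi_pos.ne
  rw [map_mul, map_mul, ← exp_conj]
  congr 1
  · simp
  · congr 1
    · have h3 := conj_cpow (τ : ℂ) (a - 1) h2
      rw [conj_ofReal, e] at h3
      exact h3.symm
    · rw [show 1 + (starRingEnd ℂ) α * τ = (starRingEnd ℂ) (1 + α * τ) by simp,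
        conj_cpow _ _ h1, e]

lemma laplaceMellin_legendreKernel (a : ℝ) {α : ℂ} (hα : α ∈ slitPlane) (t : ℝ) :
    laplaceMellin t 1 (fun τ => legendreKernel a α ((starRingEnd ℂ) α) τ) =
      ((∫ τ in Ioi (0 : ℝ), Real.exp (-(t * τ)) * (legendreFun a (normSq (1 + α * τ) : ℝ)).re : ℝ) : ℂ) := by
  rw [laplaceMellin]
  refine Eq.trans ?_ (integral_ofReal (𝕜 := ℂ))
  refine setIntegral_congr_fun measurableSet_Ioi fun τ hτ => ?_
  have h1 := slitPlane_ne_zero (one_add_mul_ofReal_mem_slitPlane hα (le_of_lt hτ))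
  simp only [legendreKernel_ofReal, sub_self, cpow_zero, one_mul]
  rw [← legendreFun_ofReal_re a (normSq_pos.2 h1), ofReal_re]
  refine Eq.trans ?_ (ofReal_mul _ _).symm
  rw [ofReal_exp]
  push_cast
  rfl

/-- At k = 0 both exponents in Whittaker's integral equal |ν| - 1/2; substituting u = tτ moves t out
of the second power. -/
lemma besselK_eq_laplaceMellin (ν : ℝ) {x : ℂ} (hx : x ≠ 0) {t : ℝ} (ht : 0 < t) :
    besselK ν (t * x) = ((Real.pi : ℂ) / (2 * (t * x))) ^ ((1 / 2 : ℝ) : ℂ) * (cexp (-(t * x)) /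
      Gamma ((|ν| + 1 / 2 : ℝ) : ℂ) * ((t : ℂ) ^ ((|ν| + 1 / 2 : ℝ) : ℂ) *
        laplaceMellin t (|ν| + 1 / 2 : ℝ)
          fun τ => (1 + (2 * x)⁻¹ * τ) ^ (((|ν| + 1 / 2 : ℝ) : ℂ) - 1))) := by
  have ht0 : (t : ℂ) ≠ 0 := by exact_mod_cast ht.ne'
  have h := laplaceMellin_one_eq_rpow_mul ht ((|ν| + 1 / 2 : ℝ) : ℂ)
    fun u => (1 + u / (2 * (t * x))) ^ (((|ν| + 1 / 2 : ℝ) : ℂ) - 1)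
  have e : ∀ τ : ℝ, 1 + ((t * τ : ℝ) : ℂ) / (2 * (t * x)) = 1 + (2 * x)⁻¹ * τ := fun τ => by
    push_cast; field_simp
  simp only [e] at h
  rw [← h, besselK, whittakerW, laplaceMellin, cpow_zero, mul_one]
  congr 2
  · push_cast; rfl
  · congr 2
    · ring
    · push_cast; ring
  · refine integral_congr_ae (Eventually.of_forall fun u => ?_)
    have e1 : ((|ν| : ℝ) : ℂ) - 0 - 1 / 2 = ((|ν| + 1 / 2 : ℝ) : ℂ) - 1 := by push_cast; ring
    have e2 : ((|ν| : ℝ) : ℂ) + 0 - 1 / 2 = ((|ν| + 1 / 2 : ℝ) : ℂ) - 1 := by push_cast; ring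
    simp only [e1, e2, ofReal_one, one_mul, mul_assoc]

lemma exp_mul_norm_besselK_sq (ν : ℝ) {x : ℂ} (hx : x ∈ slitPlane) {t : ℝ} (ht : 0 < t) :
    Real.exp (2 * t * x.re) * ‖besselK ν (t * x)‖ ^ 2 =
      Real.pi / (2 * ‖x‖) * ∫ τ in Ioi (0 : ℝ), Real.exp (-(t * τ)) *
        (legendreFun (|ν| + 1 / 2) (normSq (1 + (2 * x)⁻¹ * τ) : ℝ)).re := by
  have hx0 : x ≠ 0 := slitPlane_ne_zero hx
  have hα := inv_two_mul_mem_slitPlane hx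
  have ha : 0 < |ν| + 1 / 2 := by positivity
  rw [besselK_eq_laplaceMellin ν hx0 ht]
  generalize |ν| + 1 / 2 = a at ha ⊢
  have hp := laplaceMellin_product ha hα ht
  rw [← conj_laplaceMellin t a hα, mul_conj, laplaceMellin_legendreKernel a hα] at hp
  generalize laplaceMellin t a (fun τ => (1 + (2 * x)⁻¹ * τ) ^ (a - 1 : ℂ)) = L at hp ⊢
  generalize (∫ τ in Ioi (0 : ℝ), Real.exp (-(t * τ)) *
    (legendreFun a (normSq (1 + (2 * x)⁻¹ * τ) : ℝ)).re) = J at hp ⊢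
  have hp' : ‖L‖ ^ 2 = Real.Gamma a ^ 2 * t ^ (1 - 2 * a) * J := by
    rw [← normSq_eq_norm_sq]
    have e : (t : ℂ) ^ (1 - 2 * a : ℂ) = ((t ^ (1 - 2 * a) : ℝ) : ℂ) := by
      rw [ofReal_cpow ht.le]; push_cast; rfl
    rw [e, Gamma_ofReal] at hp
    exact_mod_cast hp
  have hG : Real.Gamma a ≠ 0 := (Real.Gamma_pos_of_pos ha).ne'
  have hn : 0 < ‖x‖ := norm_pos_iff.2 hx0
  rw [norm_mul, norm_mul, norm_div, norm_mul, norm_cpow_real, norm_cpow_real, Gamma_ofReal,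
    norm_real, norm_real, Real.norm_of_nonneg ht.le, Complex.norm_exp, mul_pow, mul_pow, mul_pow, div_pow, hp',
    norm_div, norm_mul, norm_mul, norm_real, norm_real, Real.norm_of_nonneg ht.le,
    Real.norm_of_nonneg Real.pi_pos.le, Real.norm_eq_abs, sq_abs, ← Real.sqrt_eq_rpow,
    Real.sq_sqrt (by positivity)]
  have e1 : Real.exp (-(t * x)).re ^ 2 = (Real.exp (2 * t * x.re))⁻¹ := by
    rw [← Real.exp_nat_mul, ← Real.exp_neg]
    congr 1
    simp
    ring
  -- The surviving factor t cancels the 1/t coming from |π / (2tx)|.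
  have e2 : (t ^ a) ^ 2 * t ^ (1 - 2 * a) = t := by
    rw [← Real.rpow_natCast, ← Real.rpow_mul ht.le, ← Real.rpow_add ht]
    convert Real.rpow_one t using 2
    push_cast; ring
  rw [e1]
  have e3 : ‖(2 : ℂ)‖ = 2 := by simp
  rw [e3]
  have hE := (Real.exp_pos (2 * t * x.re)).ne'
  generalize Real.exp (2 * t * x.re) = E at hE
  generalize t ^ (1 - 2 * a) = q at e2
  generalize t ^ a = r at e2
  field_simp
  linear_combination J * e2

/-! ### Nonnegativity of the density and the angular condition -/

lemma normSq_one_add_inv_mul {x : ℂ} (hx : x ≠ 0) (τ : ℝ) :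
    normSq (1 + (2 * x)⁻¹ * τ) * (4 * normSq x) = (2 * x.re + τ) ^ 2 + 4 * x.im ^ 2 := by
  have e : (4 : ℝ) * normSq x = normSq (2 * x) := by rw [map_mul]; norm_num [normSq_apply]
  rw [e, ← map_mul, show (1 + (2 * x)⁻¹ * τ) * (2 * x) = 2 * x + τ by field_simp, normSq_apply]
  simp
  ring

lemma legendreFun_re_nonneg (ν : ℝ) {x : ℂ} (hx : x ∈ slitPlane)
    (hp : x.re < 0 → largestNegativeZero ν ≤ ((-(x.re ^ 2 / x.im ^ 2) : ℝ) : EReal)) {τ : ℝ}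
    (hτ : 0 ≤ τ) : 0 ≤ (legendreFun (|ν| + 1 / 2) (normSq (1 + (2 * x)⁻¹ * τ) : ℝ)).re := by
  have hx0 := slitPlane_ne_zero hx
  have hN : 0 < normSq x := normSq_pos.2 hx0
  have hNe : normSq x = x.re ^ 2 + x.im ^ 2 := by rw [normSq_apply]; ring
  have h := normSq_one_add_inv_mul hx0 τ
  set ρ := normSq (1 + (2 * x)⁻¹ * τ) with hρ
  rcases le_or_gt 1 ρ with h1 | h1
  · exact (legendreFun_ofReal_pos _ h1).le
  -- If Re x ≥ 0, then |2x + τ| ≥ |2x| for τ ≥ 0, which contradicts ρ < 1.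
  have hre : x.re < 0 := by
    by_contra! hre
    nlinarith [mul_nonneg hre hτ]
  have him : 0 < x.im ^ 2 := by
    rcases hx with h2 | h2
    · exact absurd h2 (not_lt.2 hre.le)
    · positivity
  -- Dropping the square (2 Re x + τ)² gives the minimum of ρ over real τ, namely (Im x)² / |x|².
  have hle : x.im ^ 2 ≤ ρ * normSq x := by nlinarith [sq_nonneg (2 * x.re + τ)]
  have hρ0 : 0 < ρ := pos_of_mul_pos_left (lt_of_lt_of_le him hle) hN.le
  have hcomm : legendreFun (|ν| + 1 / 2) ρ = legendreFun (ν + 1 / 2) ρ := by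
    rcases abs_cases ν with ⟨h2, _⟩ | ⟨h2, _⟩
    · rw [h2]
    · rw [h2, ← legendreFun_comm (ν + 1 / 2) hρ0 (by linarith)]
      congr 1; ring
  rw [hcomm, legendreFun_eq_hypergeometricF _ hρ0]
  refine mul_nonneg (Real.rpow_nonneg hρ0.le _) (hypergeometricF_nonneg ν ?_ ?_)
  · rw [sub_neg, one_lt_div hρ0]; exact h1
  · refine (hp hre).trans (EReal.coe_le_coe_iff.2 ?_)
    have h3 : 1 / ρ ≤ normSq x / x.im ^ 2 := by
      rw [div_le_div_iff₀ hρ0 him]; linarith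
    have h4 : normSq x / x.im ^ 2 = x.re ^ 2 / x.im ^ 2 + 1 := by
      rw [hNe, add_div, div_self him.ne']
    linarith

lemma strictlyCompletelyMonotone_exp_mul_norm_besselK_sq (ν : ℝ) {x : ℂ} (hx : x ∈ slitPlane)
    (hp : x.re < 0 → largestNegativeZero ν ≤ ((-(x.re ^ 2 / x.im ^ 2) : ℝ) : EReal)) :
    StrictlyCompletelyMonotone
      (fun t : ℝ => Real.exp (2 * t * x.re) * ‖besselK ν ((t : ℂ) * x)‖ ^ 2) := by
  have hx0 := slitPlane_ne_zero hx
  have hα := inv_two_mul_mem_slitPlane hx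
  have hc : 0 < Real.pi / (2 * ‖x‖) := by
    have := norm_pos_iff.2 hx0
    have := Real.pi_pos
    positivity
  have hT := tameOn_legendreKernel (|ν| + 1 / 2) hα
  simp only [legendreKernel_ofReal] at hT
  refine strictlyCompletelyMonotone_of_laplace (h := fun τ => Real.pi / (2 * ‖x‖) *
    (legendreFun (|ν| + 1 / 2) (normSq (1 + (2 * x)⁻¹ * τ) : ℝ)).re)
    (continuousOn_const.mul (continuous_re.comp_continuousOn hT.1))
    (fun τ hτ => mul_nonneg hc.le (legendreFun_re_nonneg ν hx hp hτ.le)) ?_ (fun t ht => ?_)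
    fun t ht => ?_
  · simpa [legendreFun_one] using hc
  · have h := (hT.integrableOn ht (s := 1) one_pos).re.const_mul (Real.pi / (2 * ‖x‖))
    refine h.congr (Eventually.of_forall fun τ => ?_)
    have e : cexp (-(t * τ)) = ((Real.exp (-(t * τ)) : ℝ) : ℂ) := by push_cast; rfl
    simp only [sub_self, cpow_zero, one_mul, e, RCLike.re_eq_complex_re, re_ofReal_mul]
    ring
  · rw [exp_mul_norm_besselK_sq ν hx ht, ← integral_const_mul]
    congr 1
    ext τ
    ring

/-- The angular condition in terms of the cotangent of the argument. -/
lemma largestNegativeZero_le_of_abs_arg_le {ν θ : ℝ} (hbot : largestNegativeZero ν ≠ ⊥)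
    (h1 : Real.pi / 2 < θ) (h2 : θ < Real.pi)
    (hθ : Real.tan θ = -(1 / Real.sqrt (-(largestNegativeZero ν).toReal))) {x : ℂ}
    (harg : |arg x| ≤ θ) (hre : x.re < 0) :
    largestNegativeZero ν ≤ ((-(x.re ^ 2 / x.im ^ 2) : ℝ) : EReal) := by
  have htop : largestNegativeZero ν ≠ ⊤ := by
    refine ne_of_lt (lt_of_le_of_lt (sSup_le (a := ((0 : ℝ) : EReal)) ?_) (EReal.coe_lt_top 0))
    rintro _ ⟨z, hz, rfl⟩
    exact EReal.coe_le_coe_iff.2 hz.1.le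
  rw [← EReal.coe_toReal htop hbot, EReal.coe_le_coe_iff]
  generalize (largestNegativeZero ν).toReal = p at hθ
  have hsub : ∀ y : ℝ, Real.tan (y - Real.pi) = Real.tan y := Real.tan_sub_pi
  have hneg : Real.tan θ < 0 := by
    rw [← hsub]
    exact Real.tan_neg_of_neg_of_pi_div_two_lt (by linarith) (by linarith)
  -- Were the root 0, the convention 1 / 0 = 0 would give tan θ = 0, against tan θ < 0.
  have hsqrt : 0 < Real.sqrt (-p) := by
    by_contra! h
    have : Real.sqrt (-p) = 0 := le_antisymm h (Real.sqrt_nonneg _)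
    rw [this] at hθ
    simp [hθ] at hneg
  have hgt : Real.pi / 2 < |arg x| := by
    by_contra! h
    exact absurd (abs_arg_le_pi_div_two_iff.1 h) (not_le.2 hre)
  -- Shifting by the period π moves both angles into (-π/2, 0), where tan is increasing.
  have htan : Real.tan |arg x| ≤ Real.tan θ := by
    rw [← hsub |arg x|, ← hsub θ]
    rcases harg.eq_or_lt with h | h
    · rw [h]
    · exact (Real.tan_lt_tan_of_lt_of_lt_pi_div_two (by linarith) (by linarith) (by linarith)).le
  have habs : Real.tan |arg x| ^ 2 = x.im ^ 2 / x.re ^ 2 := by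
    rw [← div_pow, ← tan_arg]
    rcases abs_cases (arg x) with ⟨h, _⟩ | ⟨h, _⟩
    · rw [h]
    · rw [h, Real.tan_neg, neg_sq]
  have hsq : (1 / Real.sqrt (-p)) ^ 2 ≤ x.im ^ 2 / x.re ^ 2 := by
    rw [← habs, ← neg_sq (Real.tan _)]
    refine pow_le_pow_left₀ (by positivity) ?_ 2
    linarith
  have hp0 : 0 < -p := Real.sqrt_pos.1 hsqrt
  have hre2 : 0 < x.re ^ 2 := by nlinarith
  rw [div_pow, one_pow, Real.sq_sqrt hp0.le, div_le_div_iff₀ hp0 hre2, one_mul] at hsq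
  have him : 0 < x.im ^ 2 := by
    by_contra! h
    nlinarith
  rw [le_neg, div_le_iff₀ him]
  linarith

theorem corollary3p6 (ν : ℝ) :
    (largestNegativeZero ν = ⊥ →
      ∀ x : ℂ, x ≠ 0 → |Complex.arg x| < Real.pi →
        StrictlyCompletelyMonotone
          (fun t : ℝ => Real.exp (2 * t * x.re) * ‖besselK ν ((t : ℂ) * x)‖ ^ 2)) ∧
    (largestNegativeZero ν ≠ ⊥ →
      ∀ θ : ℝ, Real.pi / 2 < θ → θ < Real.pi →
        Real.tan θ = -(1 / Real.sqrt (-(largestNegativeZero ν).toReal)) →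
        ∀ x : ℂ, x ≠ 0 → |Complex.arg x| ≤ θ →
          StrictlyCompletelyMonotone
            (fun t : ℝ => Real.exp (2 * t * x.re) * ‖besselK ν ((t : ℂ) * x)‖ ^ 2)) := by
  have hslit : ∀ x : ℂ, x ≠ 0 → |arg x| < Real.pi → x ∈ slitPlane := fun x hx h =>
    mem_slitPlane_iff_arg.2 ⟨((le_abs_self _).trans_lt h).ne, hx⟩
  refine ⟨fun hbot x hx harg => ?_, fun hbot θ h1 h2 hθ x hx harg => ?_⟩
  · exact strictlyCompletelyMonotone_exp_mul_norm_besselK_sq ν (hslit x hx harg)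
      fun _ => hbot ▸ bot_le
  · exact strictlyCompletelyMonotone_exp_mul_norm_besselK_sq ν (hslit x hx (harg.trans_lt h2))
      fun hre => largestNegativeZero_le_of_abs_arg_le hbot h1 h2 hθ harg hre
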